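/- Let $X$ be a finite set, write $\binom{X}{k}$ for the set of $k$-element subsets of $X$, and let $r$ be a function with domain $\binom{X}{2}$ and arbitrary values (the pair $(X,r)$ is called a finite colored space). For $Y,Z\subseteq X$ write $Y\simeq_r Z$ if there is a bijection $f:Y\to Z$ with $r(U)=r(f(U))$ for all $U\in\binom{Y}{2}$, and let $a_k(r)$ be the number of equivalence classes of $\simeq_r$ on $\binom{X}{k}$; thus $a_2(r)=|\mathrm{Im}(r)|$. The color classes of $r$ are the sets $r^{-1}(\alpha)$ with $\alpha\in\mathrm{Im}(r)$; they form a partition $P$ of $\binom{X}{2}$. A set of edges $E\subseteq\binom{X}{2}$ is a matching if any two distinct members of $E$ are disjoint. A family $M$ of sets of edges consists of disjoint matchings if each member of $M$ is a matching and the union $\bigcup M$ is also a matching. Theorem. Suppose that $|X|\ge 9$ and $4\le a_2(r)=a_3(r)$. Then one of the following holds. (i) There is a family $M$ of disjoint matchings such that $P$ consists of the members of $M$ and the set of all remaining edges $\binom{X}{2}\setminus\bigcup M$. (ii) There are nonempty disjoint sets $Y,Z$ with $X=Y\cup Z$ and a family $M$ of disjoint matchings, all of whose edges have one end in $Y$ and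 the other in $Z$, such that $P$ consists of the set $\binom{Y}{2}\cup\binom{Z}{2}$, the members of $M$, and the set of all remaining edges $\binom{X}{2}\setminus\left(\binom{Y}{2}\cup\binom{Z}{2}\cup\bigcup M\right)$. (iii) There are distinct $y,z\in X$ such that $P$ consists of the four sets $\{\{y,z\}\}$, $\{\{y,u\}: u\in X\setminus\{y,z\}\}$, $\{\{z,u\}: u\in X\setminus\{y,z\}\}$ and $\binom{X\setminus\{y,z\}}{2}$; in this case $a_2(r)=a_3(r)=4$. -/

import Mathlib

namespace ColoredSpace

/-- The set of 2-subsets of `X`. A colored space is a type `X` with a map `r : Pair X → C`. -/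
abbrev Pair (X : Type*) : Type _ := {U : Finset X // U.card = 2}

/-- The image of a 2-subset under an injection. -/
def Pair.map {X Y : Type*} (f : X ↪ Y) (U : Pair X) : Pair Y :=
  ⟨U.1.map f, (Finset.card_map f).trans U.2⟩

/-- The coloring `r_Y` of the 2-subsets of `Y` induced by `r`. -/
def restrict {X C : Type*} (r : Pair X → C) (Y : Finset X) : Pair Y → C :=
  fun U => r (U.map (Function.Embedding.subtype (fun x => x ∈ Y)))

/-- `Y` is isometric to `Z`: some bijection `f : Y → Z` satisfies `r_Y = r_Z ∘ f`. -/
def Isometric {X C : Type*} (r : Pair X → C) (Y Z : Finset X) : Prop :=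
  ∃ f : Y ≃ Z, restrict r Y = restrict r Z ∘ Pair.map f.toEmbedding

/-- `A_k(r)`, the set of isometry classes `[Y]` of `k`-subsets `Y` of `X`. -/
def isometryClasses {X C : Type*} (r : Pair X → C) (k : ℕ) : Set (Set (Finset X)) :=
  (fun Y => {Z | Isometric r Y Z}) '' {Y : Finset X | Y.card = k}

/-- `a_k(r)`, the number of isometry classes of `k`-subsets. -/
noncomputable def a {X C : Type*} (k : ℕ) (r : Pair X → C) : ℕ := (isometryClasses r k).ncard

/-- The partition of the set of 2-subsets into color classes (of the colors that occur). -/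
def colorClasses {X C : Type*} (r : Pair X → C) : Set (Set (Pair X)) :=
  (fun α => r ⁻¹' {α}) '' Set.range r

/-- No two distinct edges share a vertex. -/
def IsMatching {X : Type*} (E : Set (Pair X)) : Prop :=
  ∀ U ∈ E, ∀ V ∈ E, U ≠ V → Disjoint U.1 V.1

/-- Every member of the family is a matching, and so is the union of the family. -/
def DisjointMatchings {X : Type*} (M : Set (Set (Pair X))) : Prop :=
  (∀ E ∈ M, IsMatching E) ∧ IsMatching (⋃₀ M)

/-- All edges of the complete graph on `S`. -/
def clique {X : Type*} (S : Set X) : Set (Pair X) := {U | (U.1 : Set X) ⊆ S}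

/-- All edges with one end in `S` and the other end in `T`. -/
def between {X : Type*} (S T : Set X) : Set (Pair X) :=
  {U | ∃ s ∈ S, ∃ t ∈ T, (U.1 : Set X) = {s, t}}

/-- Form (i): disjoint matchings and the class of all remaining edges. -/
def MatchingForm {X : Type*} (P : Set (Set (Pair X))) : Prop :=
  ∃ M : Set (Set (Pair X)), DisjointMatchings M ∧ P = M ∪ {(⋃₀ M)ᶜ}

/-- Form (ii): `X` is the disjoint union of nonempty sets `Y` and `Z`; the classes are the union
of the cliques on `Y` and `Z`, disjoint matchings consisting of edges between `Y` and `Z`, and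
the class of all remaining edges. -/
def TwoCliqueForm {X : Type*} (P : Set (Set (Pair X))) : Prop :=
  ∃ Y Z : Set X, Y.Nonempty ∧ Z.Nonempty ∧ Disjoint Y Z ∧ Y ∪ Z = Set.univ ∧
    ∃ M : Set (Set (Pair X)), DisjointMatchings M ∧ (∀ E ∈ M, E ⊆ between Y Z) ∧
      P = {clique Y ∪ clique Z} ∪ M ∪ {(clique Y ∪ clique Z ∪ ⋃₀ M)ᶜ}

/-- Form (iii): the classes are a single edge `{y, z}`, the edges from `y` to the other points,
the edges from `z` to the other points, and the edges among the other points (all remaining edges). -/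
def SingleEdgeForm {X : Type*} (P : Set (Set (Pair X))) : Prop :=
  ∃ y z : X, y ≠ z ∧
    P = {between {y} {z}, between {y} {y, z}ᶜ, between {z} {y, z}ᶜ,
      (between {y} {z} ∪ between {y} {y, z}ᶜ ∪ between {z} {y, z}ᶜ)ᶜ}

end ColoredSpace

/-! Call the multiset of the three colors of a triangle its type. Summing a weight on the colors
over each type is a linear map, injective as soon as there are five points (`typeSum_injective`).
Triangles of distinct types are not isometric, so the hypothesis `a 2 r = a 3 r` leaves at most as
many types as colors. The map is therefore bijective, and each type `t` receives a weight on the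
colors that sums to 1 over `t` and to 0 over every other type. Consequently a multiset of types is
determined by its total colors (`eq_of_sum_eq`): two collections of triangles using the same colors
with the same multiplicities have the same types. Most steps compare two such collections inside a
few points.

The argument divides according to `Split` pairs. Without them, any two points agree on all but at
most three others (`not_four_of_not_split`). If some point distinguishes two others, this yields a
set of at least four points joined to the outside in a single color `u` (`join_of_not_split`), and
further exchanges show that edges of other colors form a matching (`matching_of_not_split`). With a
split pair there is a triangle of one color `γ` seen by some point in one color `α ≠ γ`. If another
point sees it in a third color, octahedra force the single edge form (`single_edge_of_cones`).
Otherwise the triangle and the points seeing it in `γ` make up one clique, all other points the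
second, and edges across that are not of color `α` form a matching (`two_cliques_of_cone`). -/

namespace ColoredSpace

/-! ### Triangle types and the exchange principle -/

/-- The multiset of the three colors of a triangle. -/
def tri {C : Type*} (p q s : C) : Multiset C := {p} + {q} + {s}

theorem tri_eq_iff {C : Type*} {p q s p' q' s' : C} : tri p q s = tri p' q' s' ↔
    (p = p' ∧ (q = q' ∧ s = s' ∨ q = s' ∧ s = q')) ∨
    (p = q' ∧ (q = p' ∧ s = s' ∨ q = s' ∧ s = p')) ∨
    (p = s' ∧ (q = p' ∧ s = q' ∨ q = q' ∧ s = p')) := by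
  classical
  constructor
  · intro h
    have hp : p ∈ tri p' q' s' := by rw [← h]; simp [tri]
    have hpair : ∀ {a b c d : C}, ({a} + {b} : Multiset C) = {c} + {d} →
        a = c ∧ b = d ∨ a = d ∧ b = c := by
      intro a b c d hh
      have ha : a ∈ ({c} + {d} : Multiset C) := by rw [← hh]; simp
      simp only [Multiset.mem_add, Multiset.mem_singleton] at ha
      rcases ha with rfl | rfl
      · left; refine ⟨rfl, ?_⟩; simpa using hh
      · right; refine ⟨rfl, ?_⟩
        rw [add_comm ({c} : Multiset C)] at hh; simpa using hh
    simp only [tri, Multiset.mem_add, Multiset.mem_singleton] at hp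
    rcases hp with (rfl | rfl) | rfl
    · left; refine ⟨rfl, hpair ?_⟩
      have : ({p} + ({q} + {s}) : Multiset C) = {p} + ({q'} + {s'}) := by
        simpa only [tri, add_assoc] using h
      exact add_left_cancel this
    · right; left; refine ⟨rfl, hpair ?_⟩
      have : ({p} + ({q} + {s}) : Multiset C) = {p} + ({p'} + {s'}) := by
        have e : ({p} + ({p'} + {s'}) : Multiset C) = {p'} + {p} + {s'} := by abel
        rw [e]; simpa only [tri, add_assoc] using h
      exact add_left_cancel this
    · right; right; refine ⟨rfl, hpair ?_⟩
      have : ({p} + ({q} + {s}) : Multiset C) = {p} + ({p'} + {q'}) := by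
        have e : ({p} + ({p'} + {q'}) : Multiset C) = {p'} + {q'} + {p} := by abel
        rw [e]; simpa only [tri, add_assoc] using h
      exact add_left_cancel this
  · rintro (⟨rfl, ⟨rfl, rfl⟩ | ⟨rfl, rfl⟩⟩ | ⟨rfl, ⟨rfl, rfl⟩ | ⟨rfl, rfl⟩⟩ |
      ⟨rfl, ⟨rfl, rfl⟩ | ⟨rfl, rfl⟩⟩) <;> unfold tri <;> abel

theorem tri_comm {C : Type*} (p q s : C) : tri p q s = tri q p s := by
  unfold tri; abel

theorem tri_cancel {C : Type*} {p q s q' s' : C} (h : tri p q s = tri p q' s') :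
    q = q' ∧ s = s' ∨ q = s' ∧ s = q' := by
  rw [tri_eq_iff] at h
  grind

/-- The multisets of colors of triangles. -/
def IsType {X C : Type*} (col : X → X → C) (t : Multiset C) : Prop :=
  ∃ x y z, x ≠ y ∧ x ≠ z ∧ y ≠ z ∧ t = tri (col x y) (col x z) (col y z)

/-- Weights on the colors dual to the triangle types. -/
structure DualWeights {X C : Type*} (col : X → X → C) where
  symm : ∀ x y, col x y = col y x
  w : Multiset C → C → ℚ
  self : ∀ t, IsType col t → (t.map (w t)).sum = 1
  other : ∀ s t, IsType col s → s ≠ t → (s.map (w t)).sum = 0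
  sep : ∀ x y x' y', x ≠ y → x' ≠ y' →
    (∀ t, w t (col x y) ≤ w t (col x' y')) → col x y = col x' y'

namespace DualWeights

variable {X C : Type*} {col : X → X → C}

theorem isType {x y z : X} (hxy : x ≠ y) (hxz : x ≠ z) (hyz : y ≠ z) :
    IsType col (tri (col x y) (col x z) (col y z)) := ⟨x, y, z, hxy, hxz, hyz, rfl⟩

/-- Multisets of triangle types are determined by their total colors. -/
theorem eq_of_sum_eq (D : DualWeights col) {M N : Multiset (Multiset C)}
    (hM : ∀ t ∈ M, IsType col t) (hN : ∀ t ∈ N, IsType col t) (h : M.sum = N.sum) : M = N := by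
  classical
  -- Evaluating the weight of `t` on the total colors counts the occurrences of `t`.
  have key : ∀ (t : Multiset C) (L : Multiset (Multiset C)), (∀ s ∈ L, IsType col s) →
      ((L.sum.map (D.w t)).sum : ℚ) = L.count t := by
    intro t L
    induction L using Multiset.induction with
    | empty => simp
    | cons s L ih =>
      intro hL
      have hs := hL s (Multiset.mem_cons_self _ _)
      rw [Multiset.sum_cons, Multiset.map_add, Multiset.sum_add,
        ih fun u hu => hL u (Multiset.mem_cons_of_mem hu)]
      by_cases e : s = t
      · subst e
        rw [D.self s hs, Multiset.count_cons_self]; push_cast; ring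
      · rw [D.other s t hs e, Multiset.count_cons_of_ne (Ne.symm e)]; ring
  ext t
  have := key t M hM
  rw [h, key t N hN] at this
  exact_mod_cast this.symm

theorem two (D : DualWeights col) {t₁ t₂ s₁ s₂ : Multiset C} (ht₁ : IsType col t₁)
    (ht₂ : IsType col t₂) (hs₁ : IsType col s₁) (hs₂ : IsType col s₂) (h : t₁ + t₂ = s₁ + s₂) :
    t₁ = s₁ ∧ t₂ = s₂ ∨ t₁ = s₂ ∧ t₂ = s₁ := by
  have := D.eq_of_sum_eq (M := {t₁, t₂}) (N := {s₁, s₂}) (by simp [ht₁, ht₂])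
    (by simp [hs₁, hs₂]) (by simpa using h)
  have h' : ({t₁, t₂} : Multiset (Multiset C)) = {s₁, s₂} := this
  have hm : t₁ ∈ ({s₁, s₂} : Multiset (Multiset C)) := by rw [← h']; simp
  simp only [Multiset.insert_eq_cons, Multiset.mem_cons, Multiset.mem_singleton] at hm
  rcases hm with rfl | rfl
  · left; exact ⟨rfl, by simpa using h⟩
  · right; refine ⟨rfl, ?_⟩; rw [add_comm s₁] at h; simpa using h

theorem three (D : DualWeights col) {t₁ t₂ t₃ s₁ s₂ s₃ : Multiset C} (ht₁ : IsType col t₁)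
    (ht₂ : IsType col t₂) (ht₃ : IsType col t₃) (hs₁ : IsType col s₁) (hs₂ : IsType col s₂)
    (hs₃ : IsType col s₃) (h : t₁ + t₂ + t₃ = s₁ + s₂ + s₃) :
    (s₁ = t₁ ∧ (s₂ = t₂ ∧ s₃ = t₃ ∨ s₂ = t₃ ∧ s₃ = t₂)) ∨
    (s₁ = t₂ ∧ (s₂ = t₁ ∧ s₃ = t₃ ∨ s₂ = t₃ ∧ s₃ = t₁)) ∨
    (s₁ = t₃ ∧ (s₂ = t₁ ∧ s₃ = t₂ ∨ s₂ = t₂ ∧ s₃ = t₁)) := by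
  have h' := D.eq_of_sum_eq (M := {t₁, t₂, t₃}) (N := {s₁, s₂, s₃}) (by simp [ht₁, ht₂, ht₃])
    (by simp [hs₁, hs₂, hs₃]) (by simpa [add_assoc] using h)
  rw [← tri_eq_iff]
  simpa [tri, Multiset.insert_eq_cons, ← Multiset.singleton_add, add_assoc] using h'.symm

theorem four (D : DualWeights col) {t₁ t₂ t₃ t₄ s₁ s₂ s₃ s₄ : Multiset C} (ht₁ : IsType col t₁)
    (ht₂ : IsType col t₂) (ht₃ : IsType col t₃) (ht₄ : IsType col t₄) (hs₁ : IsType col s₁)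
    (hs₂ : IsType col s₂) (hs₃ : IsType col s₃) (hs₄ : IsType col s₄)
    (h : t₁ + t₂ + t₃ + t₄ = s₁ + s₂ + s₃ + s₄) :
    s₄ = t₁ ∨ s₄ = t₂ ∨ s₄ = t₃ ∨ s₄ = t₄ := by
  have h' := D.eq_of_sum_eq (M := {t₁, t₂, t₃, t₄}) (N := {s₁, s₂, s₃, s₄})
    (by simp [ht₁, ht₂, ht₃, ht₄]) (by simp [hs₁, hs₂, hs₃, hs₄]) (by simpa [add_assoc] using h)
  have hm : s₄ ∈ ({t₁, t₂, t₃, t₄} : Multiset (Multiset C)) := by rw [h']; simp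
  simpa using hm

end DualWeights
-- Comparing two points that are not split
namespace DualWeights
variable {X C : Type*} {col : X → X → C}

/-- `a` and `b` see three common points each in a constant color, the two colors being distinct. -/
def Split (col : X → X → C) (a b : X) : Prop :=
  a ≠ b ∧ ∃ c d e, c ≠ d ∧ c ≠ e ∧ d ≠ e ∧ (c ≠ a ∧ c ≠ b) ∧ (d ≠ a ∧ d ≠ b) ∧ (e ≠ a ∧ e ≠ b) ∧
    col a d = col a c ∧ col a e = col a c ∧ col b d = col b c ∧ col b e = col b c ∧
    col a c ≠ col b c

theorem Split.symm {a b : X} (h : Split col a b) : Split col b a := by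
  obtain ⟨hab, c, d, e, h1, h2, h3, h4, h5, h6, h7, h8, h9, h10, h11⟩ := h
  exact ⟨hab.symm, c, d, e, h1, h2, h3, h4.symm, h5.symm, h6.symm, h9, h10, h7, h8, h11.symm⟩

theorem sum_tri (D : DualWeights col) (t : Multiset C) (p q s : C) :
    ((tri p q s).map (D.w t)).sum = D.w t p + D.w t q + D.w t s := by
  simp [tri, add_assoc]

/-- A pairwise sum of the differences of the weights seen from `a` and `b`. -/
theorem weight_pair (D : DualWeights col) [DecidableEq (Multiset C)] (t : Multiset C)
    {a b c d : X}
    (hc : c ≠ a ∧ c ≠ b) (hd : d ≠ a ∧ d ≠ b) (hcd : c ≠ d) :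
    (D.w t (col a c) - D.w t (col b c)) + (D.w t (col a d) - D.w t (col b d)) =
      (if tri (col a c) (col a d) (col c d) = t then 1 else 0) -
      (if tri (col b c) (col b d) (col c d) = t then 1 else 0) := by
  have key : ∀ x : X, c ≠ x → d ≠ x → D.w t (col x c) + D.w t (col x d) + D.w t (col c d) =
      if tri (col x c) (col x d) (col c d) = t then 1 else 0 := by
    intro x h1 h2
    have hT : IsType col (tri (col x c) (col x d) (col c d)) := isType h1.symm h2.symm hcd
    rw [← D.sum_tri t]
    split_ifs with h
    · rw [h]; rw [h] at hT; exact D.self t hT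
    · exact D.other _ t hT h
  have h1 := key a hc.1 hd.1
  have h2 := key b hc.2 hd.2
  linarith

/-- Points are split by a triple over whose pairs each of them has a constant triangle type. -/
theorem split_of_equal_types {a b c d e : X} (hab : a ≠ b)
    (hc : c ≠ a ∧ c ≠ b) (hd : d ≠ a ∧ d ≠ b) (he : e ≠ a ∧ e ≠ b)
    (hcd : c ≠ d) (hce : c ≠ e) (hde : d ≠ e)
    (a₁ : tri (col a c) (col a d) (col c d) = tri (col a c) (col a e) (col c e))
    (a₂ : tri (col a c) (col a d) (col c d) = tri (col a d) (col a e) (col d e))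
    (b₁ : tri (col b c) (col b d) (col c d) = tri (col b c) (col b e) (col c e))
    (b₂ : tri (col b c) (col b d) (col c d) = tri (col b d) (col b e) (col d e))
    (hne : tri (col a c) (col a d) (col c d) ≠ tri (col b c) (col b d) (col c d)) :
    Split col a b := by
  -- At each of `a` and `b`, cancellation leaves two options: a constant color towards `c`, `d`,
  -- `e`, which makes that triangle monochromatic, or equal colors on opposite edges of the
  -- tetrahedron. In the second option the triangle determines the three edges, so `hne` rules it
  -- out for both points at once. If one point is constant, the triangle is monochromatic and the
  -- other is constant as well.
  have a₁ := tri_cancel a₁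
  have a₂ := tri_cancel (a₂.symm.trans (tri_comm _ _ _))
  have b₁ := tri_cancel b₁
  have b₂ := tri_cancel (b₂.symm.trans (tri_comm _ _ _))
  have hne : ¬ (col a c = col b c ∧ col a d = col b d) := by
    rintro ⟨h1, h2⟩; exact hne (by rw [h1, h2])
  refine ⟨hab, c, d, e, hcd, hce, hde, hc, hd, he, ?_⟩
  generalize col a c = p₁ at *
  generalize col a d = p₂ at *
  generalize col a e = p₃ at *
  generalize col b c = q₁ at *
  generalize col b d = q₂ at *
  generalize col b e = q₃ at *
  generalize col c d = x at *
  generalize col c e = y at *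
  generalize col d e = z at *
  clear hc hd he hcd hce hde hab
  grind

/-- In `weight_pair` a positive left side means that the triangle at `a` has type `t` and the one at
`b` does not. So all six triangles at `a` have type `t`, which equates the color pairs of the three
perfect matchings on the `cᵢ`. By exchange, the three matchings then carry the same pair of types at
`b`, and some three `cᵢ` have the same type at `b` over all their pairs. -/
theorem split_of_four (D : DualWeights col) {a b c₁ c₂ c₃ c₄ : X} (t : Multiset C) (hab : a ≠ b)
    (h₁ : c₁ ≠ a ∧ c₁ ≠ b) (h₂ : c₂ ≠ a ∧ c₂ ≠ b) (h₃ : c₃ ≠ a ∧ c₃ ≠ b) (h₄ : c₄ ≠ a ∧ c₄ ≠ b)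
    (h₁₂ : c₁ ≠ c₂) (h₁₃ : c₁ ≠ c₃) (h₁₄ : c₁ ≠ c₄) (h₂₃ : c₂ ≠ c₃) (h₂₄ : c₂ ≠ c₄) (h₃₄ : c₃ ≠ c₄)
    (p₁ : D.w t (col b c₁) < D.w t (col a c₁)) (p₂ : D.w t (col b c₂) < D.w t (col a c₂))
    (p₃ : D.w t (col b c₃) < D.w t (col a c₃)) (p₄ : D.w t (col b c₄) < D.w t (col a c₄)) :
    Split col a b := by
  classical
  have key : ∀ c d : X, c ≠ a ∧ c ≠ b → d ≠ a ∧ d ≠ b → c ≠ d →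
      D.w t (col b c) < D.w t (col a c) → D.w t (col b d) < D.w t (col a d) →
      tri (col a c) (col a d) (col c d) = t ∧ tri (col b c) (col b d) (col c d) ≠ t := by
    intro c d hc hd hcd hpc hpd
    have := D.weight_pair t hc hd hcd
    split_ifs at this with e1 e2 e2
    · linarith
    · exact ⟨e1, e2⟩
    · linarith
    · linarith
  obtain ⟨a12, b12⟩ := key c₁ c₂ h₁ h₂ h₁₂ p₁ p₂
  obtain ⟨a13, b13⟩ := key c₁ c₃ h₁ h₃ h₁₃ p₁ p₃
  obtain ⟨a14, b14⟩ := key c₁ c₄ h₁ h₄ h₁₄ p₁ p₄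
  obtain ⟨a23, b23⟩ := key c₂ c₃ h₂ h₃ h₂₃ p₂ p₃
  obtain ⟨a24, b24⟩ := key c₂ c₄ h₂ h₄ h₂₄ p₂ p₄
  obtain ⟨a34, b34⟩ := key c₃ c₄ h₃ h₄ h₃₄ p₃ p₄
  have T : ∀ c d : X, c ≠ a ∧ c ≠ b → d ≠ a ∧ d ≠ b → c ≠ d →
      IsType col (tri (col b c) (col b d) (col c d)) := fun c d hc hd hcd =>
    isType hc.2.symm hd.2.symm hcd
  have ea : tri (col a c₁) (col a c₂) (col c₁ c₂) + tri (col a c₃) (col a c₄) (col c₃ c₄) =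
      tri (col a c₁) (col a c₃) (col c₁ c₃) + tri (col a c₂) (col a c₄) (col c₂ c₄) := by
    rw [a12, a34, a13, a24]
  have ea' : tri (col a c₁) (col a c₂) (col c₁ c₂) + tri (col a c₃) (col a c₄) (col c₃ c₄) =
      tri (col a c₁) (col a c₄) (col c₁ c₄) + tri (col a c₂) (col a c₃) (col c₂ c₃) := by
    rw [a12, a34, a14, a23]
  have x1 : ({col c₁ c₂} + {col c₃ c₄} : Multiset C) = {col c₁ c₃} + {col c₂ c₄} := by
    apply add_left_cancel (a := ({col a c₁} + {col a c₂} + {col a c₃} + {col a c₄} : Multiset C))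
    unfold tri at ea
    convert ea using 1 <;> abel
  have x2 : ({col c₁ c₂} + {col c₃ c₄} : Multiset C) = {col c₁ c₄} + {col c₂ c₃} := by
    apply add_left_cancel (a := ({col a c₁} + {col a c₂} + {col a c₃} + {col a c₄} : Multiset C))
    unfold tri at ea'
    convert ea' using 1 <;> abel
  have e1 := D.two (T _ _ h₁ h₂ h₁₂) (T _ _ h₃ h₄ h₃₄) (T _ _ h₁ h₃ h₁₃) (T _ _ h₂ h₄ h₂₄) (by
    have := congrArg (fun m => ({col b c₁} + {col b c₂} + {col b c₃} + {col b c₄}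
      : Multiset C) + m) x1
    unfold tri
    convert this using 1 <;> abel)
  have e2 := D.two (T _ _ h₁ h₂ h₁₂) (T _ _ h₃ h₄ h₃₄) (T _ _ h₁ h₄ h₁₄) (T _ _ h₂ h₃ h₂₃) (by
    have := congrArg (fun m => ({col b c₁} + {col b c₂} + {col b c₃} + {col b c₄}
      : Multiset C) + m) x2
    unfold tri
    convert this using 1 <;> abel)
  rcases e1 with ⟨e1, e1'⟩ | ⟨e1, e1'⟩ <;> rcases e2 with ⟨e2, e2'⟩ | ⟨e2, e2'⟩
  · exact split_of_equal_types hab h₂ h₃ h₄ h₂₃ h₂₄ h₃₄ (by rw [a23, a24]) (by rw [a23, a34])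
      (e2'.symm.trans e1') e2'.symm (by rw [a23]; exact b23.symm)
  · exact split_of_equal_types hab h₁ h₂ h₃ h₁₂ h₁₃ h₂₃ (by rw [a12, a13]) (by rw [a12, a23])
      e1 e2 (by rw [a12]; exact b12.symm)
  · exact split_of_equal_types hab h₁ h₂ h₄ h₁₂ h₁₄ h₂₄ (by rw [a12, a14]) (by rw [a12, a24])
      e2 e1 (by rw [a12]; exact b12.symm)
  · exact split_of_equal_types hab h₁ h₃ h₄ h₁₃ h₁₄ h₃₄ (by rw [a13, a14]) (by rw [a13, a34])
      (e1'.symm.trans e2') e1'.symm (by rw [a13]; exact b13.symm)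

end DualWeights

theorem exists_four_of_card {X : Type*} {F : Finset X} (h : 4 ≤ F.card) :
    ∃ a ∈ F, ∃ b ∈ F, ∃ c ∈ F, ∃ d ∈ F, a ≠ b ∧ a ≠ c ∧ a ≠ d ∧ b ≠ c ∧ b ≠ d ∧ c ≠ d := by
  classical
  obtain ⟨a, ha⟩ : F.Nonempty := Finset.card_pos.1 (by omega)
  have h1 : 2 < (F.erase a).card := by rw [Finset.card_erase_of_mem ha]; omega
  obtain ⟨b, c, d, hb, hc, hd, hbc, hbd, hcd⟩ := Finset.two_lt_card_iff.1 h1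
  rw [Finset.mem_erase] at hb hc hd
  exact ⟨a, ha, b, hb.2, c, hc.2, d, hd.2, hb.1.symm, hc.1.symm, hd.1.symm, hbc, hbd, hcd⟩

namespace DualWeights
variable {X C : Type*} {col : X → X → C}

/-- By `split_of_four`, at most three points have a positive difference and at most three a negative
one. With `a` and `b` these are eight points, fewer than nine. -/
theorem exists_weight_eq (D : DualWeights col) [Fintype X] (hX : 9 ≤ Fintype.card X) {a b : X}
    (hab : a ≠ b) (hs : ¬ Split col a b) (t : Multiset C) :
    ∃ z, (z ≠ a ∧ z ≠ b) ∧ D.w t (col a z) = D.w t (col b z) := by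
  classical
  by_contra! hne
  have hP : ∀ x y : X, x ≠ y → ¬ Split col x y →
      (Finset.univ.filter fun c => (c ≠ x ∧ c ≠ y) ∧
        D.w t (col y c) < D.w t (col x c)).card ≤ 3 := by
    intro x y hxy hn
    by_contra! h
    obtain ⟨c₁, h₁, c₂, h₂, c₃, h₃, c₄, h₄, h12, h13, h14, h23, h24, h34⟩ :=
      exists_four_of_card h
    simp only [Finset.mem_filter, Finset.mem_univ, true_and] at h₁ h₂ h₃ h₄
    exact hn (D.split_of_four t hxy h₁.1 h₂.1 h₃.1 h₄.1 h12 h13 h14 h23 h24 h34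
      h₁.2 h₂.2 h₃.2 h₄.2)
  have h1 := hP a b hab hs
  have h2 := hP b a hab.symm fun h => hs h.symm
  have hcov : (Finset.univ : Finset X) ⊆ {a, b} ∪
      ((Finset.univ.filter fun c => (c ≠ a ∧ c ≠ b) ∧ D.w t (col b c) < D.w t (col a c)) ∪
      (Finset.univ.filter fun c => (c ≠ b ∧ c ≠ a) ∧ D.w t (col a c) < D.w t (col b c))) := by
    intro c _
    simp only [Finset.mem_union, Finset.mem_insert, Finset.mem_singleton, Finset.mem_filter,
      Finset.mem_univ, true_and]
    by_cases ha : c = a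
    · simp [ha]
    by_cases hb : c = b
    · simp [hb]
    rcases lt_or_gt_of_ne (hne c ⟨ha, hb⟩) with h | h
    · right; right; exact ⟨⟨hb, ha⟩, h⟩
    · right; left; exact ⟨⟨ha, hb⟩, h⟩
  have := Finset.card_le_card hcov
  rw [Finset.card_univ] at this
  have u1 := Finset.card_union_le ({a, b} : Finset X)
      ((Finset.univ.filter fun c => (c ≠ a ∧ c ≠ b) ∧ D.w t (col b c) < D.w t (col a c)) ∪
      (Finset.univ.filter fun c => (c ≠ b ∧ c ≠ a) ∧ D.w t (col a c) < D.w t (col b c)))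
  have u2 := Finset.card_union_le
      (Finset.univ.filter fun c => (c ≠ a ∧ c ≠ b) ∧ D.w t (col b c) < D.w t (col a c))
      (Finset.univ.filter fun c => (c ≠ b ∧ c ≠ a) ∧ D.w t (col a c) < D.w t (col b c))
  have u3 := Finset.card_le_two (a := a) (b := b)
  omega

/-- Points that are not split see all but at most three other points in the same color. -/
theorem not_four_of_not_split (D : DualWeights col) [Fintype X] (hX : 9 ≤ Fintype.card X)
    {a b c₁ c₂ c₃ c₄ : X} (hab : a ≠ b) (hs : ¬ Split col a b)
    (h₁ : c₁ ≠ a ∧ c₁ ≠ b) (h₂ : c₂ ≠ a ∧ c₂ ≠ b) (h₃ : c₃ ≠ a ∧ c₃ ≠ b) (h₄ : c₄ ≠ a ∧ c₄ ≠ b)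
    (h₁₂ : c₁ ≠ c₂) (h₁₃ : c₁ ≠ c₃) (h₁₄ : c₁ ≠ c₄) (h₂₃ : c₂ ≠ c₃) (h₂₄ : c₂ ≠ c₄) (h₃₄ : c₃ ≠ c₄)
    (n₁ : col a c₁ ≠ col b c₁) (n₂ : col a c₂ ≠ col b c₂) (n₃ : col a c₃ ≠ col b c₃)
    (n₄ : col a c₄ ≠ col b c₄) : False := by
  classical
  -- Paired with a point of difference zero, each difference is itself a difference of two
  -- indicators.
  have hint : ∀ t c, c ≠ a ∧ c ≠ b → D.w t (col a c) - D.w t (col b c) = -1 ∨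
      D.w t (col a c) - D.w t (col b c) = 0 ∨ D.w t (col a c) - D.w t (col b c) = 1 := by
    intro t c hc
    obtain ⟨z, hz, hz0⟩ := D.exists_weight_eq hX hab hs t
    by_cases h : c = z
    · right; left; rw [h, hz0, sub_self]
    · have := D.weight_pair t hc hz h
      rw [hz0, sub_self, add_zero] at this
      rw [this]
      split_ifs <;> norm_num
  have hpos : ∀ c, c ≠ a ∧ c ≠ b → col a c ≠ col b c →
      ∃ t, D.w t (col a c) - D.w t (col b c) = 1 := by
    intro c hc hn
    by_contra! h
    apply hn
    apply D.sep a c b c hc.1.symm hc.2.symm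
    intro t
    rcases hint t c hc with e | e | e
    · linarith
    · linarith
    · exact absurd e (h t)
  have hpair : ∀ c d, c ≠ a ∧ c ≠ b → d ≠ a ∧ d ≠ b → c ≠ d → ∀ s,
      D.w s (col a c) - D.w s (col b c) = 1 →
      D.w s (col a d) - D.w s (col b d) = -1 ∨ (D.w s (col a d) - D.w s (col b d) = 0 ∧
        tri (col a c) (col a d) (col c d) = s) := by
    intro c d hc hd hcd s e
    have := D.weight_pair s hc hd hcd
    rw [e] at this
    rcases hint s d hd with e' | e' | e'
    · exact Or.inl e'
    · right; refine ⟨e', ?_⟩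
      rw [e'] at this
      split_ifs at this with k1 k2 k2 <;> first | exact k1 | norm_num at this
    · rw [e'] at this; split_ifs at this <;> norm_num at this
  have hneg : ∀ c d, c ≠ a ∧ c ≠ b → d ≠ a ∧ d ≠ b → c ≠ d → ∀ s,
      ¬ (D.w s (col a c) - D.w s (col b c) = -1 ∧ D.w s (col a d) - D.w s (col b d) = -1) := by
    rintro c d hc hd hcd s ⟨e, e'⟩
    have := D.weight_pair s hc hd hcd
    rw [e, e'] at this
    split_ifs at this <;> norm_num at this
  obtain ⟨s₁, k₁⟩ := hpos c₁ h₁ n₁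
  obtain ⟨s₂, k₂⟩ := hpos c₂ h₂ n₂
  obtain ⟨s₃, k₃⟩ := hpos c₃ h₃ n₃
  obtain ⟨s₄, k₄⟩ := hpos c₄ h₄ n₄
  -- Draw an arc from `c` to `d` when the type chosen for `c` has difference -1 at `d`. Any two of
  -- the four points are joined by an arc, while `hneg` allows each point only one outgoing arc.
  -- Five pairs already exceed the four arcs available.
  have htour : ∀ c d, c ≠ a ∧ c ≠ b → d ≠ a ∧ d ≠ b → c ≠ d → ∀ s s',
      D.w s (col a c) - D.w s (col b c) = 1 → D.w s' (col a d) - D.w s' (col b d) = 1 →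
      D.w s (col a d) - D.w s (col b d) = -1 ∨ D.w s' (col a c) - D.w s' (col b c) = -1 := by
    intro c d hc hd hcd s s' e e'
    rcases hpair c d hc hd hcd s e with h | ⟨h, h'⟩
    · exact Or.inl h
    rcases hpair d c hd hc hcd.symm s' e' with g | ⟨g, g'⟩
    · exact Or.inr g
    rw [D.symm d c, tri_comm] at g'
    rw [h'] at g'
    subst g'
    rw [e] at g; norm_num at g
  have t12 := htour c₁ c₂ h₁ h₂ h₁₂ _ _ k₁ k₂
  have t13 := htour c₁ c₃ h₁ h₃ h₁₃ _ _ k₁ k₃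
  have t14 := htour c₁ c₄ h₁ h₄ h₁₄ _ _ k₁ k₄
  have t23 := htour c₂ c₃ h₂ h₃ h₂₃ _ _ k₂ k₃
  have t24 := htour c₂ c₄ h₂ h₄ h₂₄ _ _ k₂ k₄
  have a1 := hneg c₂ c₃ h₂ h₃ h₂₃ s₁
  have a2 := hneg c₂ c₄ h₂ h₄ h₂₄ s₁
  have a3 := hneg c₃ c₄ h₃ h₄ h₃₄ s₁
  have b1 := hneg c₁ c₃ h₁ h₃ h₁₃ s₂
  have b2 := hneg c₁ c₄ h₁ h₄ h₁₄ s₂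
  have b3 := hneg c₃ c₄ h₃ h₄ h₃₄ s₂
  have d1 := hneg c₁ c₂ h₁ h₂ h₁₂ s₃
  have e1 := hneg c₁ c₂ h₁ h₂ h₁₂ s₄
  clear hint hpos hpair hneg htour
  rcases t12 with h | h <;> rcases t13 with h' | h' <;> rcases t14 with h'' | h'' <;>
    rcases t23 with g | g <;> rcases t24 with g' | g' <;>
    first
    | exact a1 ⟨h, h'⟩ | exact a2 ⟨h, h''⟩ | exact a3 ⟨h', h''⟩
    | exact b1 ⟨h, g⟩ | exact b2 ⟨h, g'⟩ | exact b3 ⟨g, g'⟩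
    | exact d1 ⟨h', g⟩ | exact e1 ⟨h'', g'⟩

end DualWeights

/-! ### Constant triangle sums -/

/-- An edge function on five points whose triangle sums are constant is constant at each vertex. -/
theorem eq_of_triangle_sum_eq {X : Type*} {f : X → X → ℚ} {N : ℚ}
    {F : Set X} (h : ∀ x ∈ F, ∀ y ∈ F, ∀ z ∈ F, x ≠ y → x ≠ z → y ≠ z → f x y + f x z + f y z = N)
    {a b c d e : X} (ha : a ∈ F) (hb : b ∈ F) (hc : c ∈ F) (hd : d ∈ F) (he : e ∈ F)
    (hab : a ≠ b) (hac : a ≠ c) (had : a ≠ d) (hae : a ≠ e) (hbc : b ≠ c) (hbd : b ≠ d)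
    (hce : c ≠ e) (hcd : c ≠ d) (hde : d ≠ e) : f a b = f a e := by
  have h1 := h a ha b hb c hc hab hac hbc
  have h2 := h a ha b hb d hd hab had hbd
  have h3 := h a ha c hc d hd hac had hcd
  have h4 := h b hb c hc d hd hbc hbd hcd
  have h5 := h a ha e he c hc hae hac hce.symm
  have h6 := h a ha e he d hd hae had hde.symm
  have h7 := h e he c hc d hd hce.symm hde.symm hcd
  linarith

theorem exists_two_others {X : Type*} {F : Finset X} (h : 5 ≤ F.card) (x y z : X) :
    ∃ d ∈ F, ∃ e ∈ F, d ≠ e ∧ (d ≠ x ∧ d ≠ y ∧ d ≠ z) ∧ (e ≠ x ∧ e ≠ y ∧ e ≠ z) := by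
  classical
  have h1 : 1 < (F \ {x, y, z}).card := by
    have := Finset.le_card_sdiff {x, y, z} F
    have h3 := Finset.card_le_three (a := x) (b := y) (c := z)
    omega
  obtain ⟨d, hd, e, he, hde⟩ := Finset.one_lt_card.1 h1
  simp only [Finset.mem_sdiff, Finset.mem_insert, Finset.mem_singleton, not_or] at hd he
  exact ⟨d, hd.1, e, he.1, hde, hd.2, he.2⟩

/-- Every triangle has equally many edges of color `col a b`, so `eq_of_triangle_sum_eq` applies to
the indicator of that color. -/
theorem eq_of_types_eq {X C : Type*} {col : X → X → C}
    {F : Finset X} (hF : 5 ≤ F.card) {t : Multiset C}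
    (h : ∀ x ∈ F, ∀ y ∈ F, ∀ z ∈ F, x ≠ y → x ≠ z → y ≠ z →
      tri (col x y) (col x z) (col y z) = t)
    {a b e : X} (ha : a ∈ F) (hb : b ∈ F) (he : e ∈ F) (hab : a ≠ b) (hae : a ≠ e) :
    col a b = col a e := by
  classical
  obtain ⟨c, hc, d, hd, hcd, ⟨c1, c2, c3⟩, d1, d2, d3⟩ := exists_two_others hF a b e
  have := eq_of_triangle_sum_eq (f := fun x y => if col a b = col x y then (1 : ℚ) else 0)
    (N := (t.count (col a b) : ℚ)) (F := F)
    (fun x hx y hy z hz hxy hxz hyz => by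
      rw [← h x hx y hy z hz hxy hxz hyz]
      simp only [tri, Multiset.count_add, Multiset.count_singleton]
      push_cast; rfl)
    ha hb hc hd he hab c1.symm d1.symm hae c2.symm d2.symm c3 hcd d3
  by_contra hne
  simp [hne] at this

/-! ### No split pairs: the matching form -/

namespace DualWeights
variable {X C : Type*} {col : X → X → C}

/-- The two halves of the faces of an octahedron have the same types. -/
theorem octahedron (D : DualWeights col) {x x' y y' z z' : X} (h₁ : x ≠ y) (h₂ : x ≠ y')
    (h₃ : x' ≠ y) (h₄ : x' ≠ y') (h₅ : x ≠ z) (h₆ : x ≠ z') (h₇ : x' ≠ z) (h₈ : x' ≠ z')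
    (h₉ : y ≠ z) (h₁₀ : y ≠ z') (h₁₁ : y' ≠ z) (h₁₂ : y' ≠ z') :
    tri (col x y) (col x z) (col y z) = tri (col x' y) (col x' z) (col y z) ∨
    tri (col x y) (col x z) (col y z) = tri (col x y') (col x z) (col y' z) ∨
    tri (col x y) (col x z) (col y z) = tri (col x y) (col x z') (col y z') ∨
    tri (col x y) (col x z) (col y z) = tri (col x' y') (col x' z') (col y' z') := by
  -- In the alternating coloring of the eight faces, each edge lies in one face of either kind.
  -- Opposite vertices span no edge and need not be distinct.
  refine D.four (isType h₃ h₇ h₉) (isType h₂ h₅ h₁₁) (isType h₁ h₆ h₁₀) (isType h₄ h₈ h₁₂)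
    (isType h₂ h₆ h₁₂) (isType h₃ h₈ h₁₀) (isType h₄ h₇ h₁₁) (isType h₁ h₅ h₉) ?_
  unfold tri
  abel

/-- If a monochromatic triangle of color `u` exists, then a triangle joined to a point by edges of
color `u` has two edges of color `u`. -/
theorem two_edges_of_cone (D : DualWeights col) {u : C} (hu : IsType col (tri u u u))
    {x y z e : X} (hxy : x ≠ y) (hxz : x ≠ z) (hyz : y ≠ z) (hxe : x ≠ e) (hye : y ≠ e)
    (hze : z ≠ e) (hx : col x e = u) (hy : col y e = u) (hz : col z e = u) :
    col x y = u ∨ col x z = u := by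
  -- The three triangles at the apex use the same colors as the base together with two triangles of
  -- type `uuu`, so two of the three are of that type.
  have h := D.three (isType hxy hxe hye) (isType hxz hxe hze) (isType hyz hye hze)
    (isType hxy hxz hyz) hu hu (by rw [hx, hy, hz]; unfold tri; abel)
  rw [hx, hy, hz] at h
  have key : ∀ p, tri u u u = tri p u u → p = u := by
    intro p hp; rw [tri_eq_iff] at hp; grind
  rcases h with ⟨_, ⟨h, _⟩ | ⟨_, h⟩⟩ | ⟨_, ⟨h, _⟩ | ⟨h, _⟩⟩ | ⟨_, ⟨h, _⟩ | ⟨_, h⟩⟩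
  · exact Or.inr (key _ h)
  · exact Or.inr (key _ h)
  · exact Or.inl (key _ h)
  · left; grind
  · exact Or.inl (key _ h)
  · exact Or.inl (key _ h)

/-- The set `E` consists of the points that see `a` and `b` alike; at most three others fail to,
whence 9 - 2 - 3 = 4. For `c'` outside `E`, swapping `e` and `e'` in the triangles `a c' e` and `b
c' e'` preserves the colors. Since `c'` distinguishes `a` from `b`, the types of `a c' e` and `a c'
e'` must agree. -/
theorem join_of_not_split (D : DualWeights col) [Fintype X] (hX : 9 ≤ Fintype.card X)
    (hns : ∀ a b, ¬ Split col a b) {a b c : X} (hab : a ≠ b) (hca : c ≠ a) (hcb : c ≠ b)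
    (hc : col c a ≠ col c b) :
    ∃ (E : Finset X) (u : C), 4 ≤ E.card ∧ a ∉ E ∧ b ∉ E ∧ c ∉ E ∧
      ∀ x ∉ E, ∀ e ∈ E, col x e = u := by
  classical
  set E : Finset X := Finset.univ.filter fun e => (e ≠ a ∧ e ≠ b) ∧ col a e = col b e with hE
  have hmem : ∀ e, e ∈ E ↔ (e ≠ a ∧ e ≠ b) ∧ col a e = col b e := by simp [hE]
  have hcE : c ∉ E := by
    rw [hmem, D.symm a c, D.symm b c]; exact fun h => hc h.2
  have hE4 : 4 ≤ E.card := by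
    have h3 : (Finset.univ.filter fun e => (e ≠ a ∧ e ≠ b) ∧ col a e ≠ col b e).card ≤ 3 := by
      by_contra! h
      obtain ⟨c₁, h₁, c₂, h₂, c₃, h₃, c₄, h₄, h12, h13, h14, h23, h24, h34⟩ :=
        exists_four_of_card h
      simp only [Finset.mem_filter, Finset.mem_univ, true_and] at h₁ h₂ h₃ h₄
      exact D.not_four_of_not_split hX hab (hns a b) h₁.1 h₂.1 h₃.1 h₄.1 h12 h13 h14 h23 h24 h34
        h₁.2 h₂.2 h₃.2 h₄.2
    have hcov : (Finset.univ : Finset X) ⊆ {a, b} ∪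
        ((Finset.univ.filter fun e => (e ≠ a ∧ e ≠ b) ∧ col a e ≠ col b e) ∪ E) := by
      intro e _
      simp only [Finset.mem_union, Finset.mem_insert, Finset.mem_singleton, Finset.mem_filter,
        Finset.mem_univ, true_and, hmem]
      tauto
    have := Finset.card_le_card hcov
    rw [Finset.card_univ] at this
    have u1 := Finset.card_union_le ({a, b} : Finset X)
      ((Finset.univ.filter fun e => (e ≠ a ∧ e ≠ b) ∧ col a e ≠ col b e) ∪ E)
    have u2 := Finset.card_union_le
      (Finset.univ.filter fun e => (e ≠ a ∧ e ≠ b) ∧ col a e ≠ col b e) E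
    have u3 := Finset.card_le_two (a := a) (b := b)
    omega
  have step : ∀ c', (c' ≠ a ∧ c' ≠ b) → c' ∉ E → ∀ e ∈ E, ∀ e' ∈ E,
      col a e = col a e' ∧ col c' e = col c' e' ∨ col a e = col c' e' ∧ col c' e = col a e' := by
    intro c' hc' hc'E e he e' he'
    have n1 : c' ≠ e := fun h => hc'E (h ▸ he)
    have n2 : c' ≠ e' := fun h => hc'E (h ▸ he')
    rw [hmem] at he he' hc'E
    have hne : col a c' ≠ col b c' := fun h => hc'E ⟨hc', h⟩
    have := D.two (isType hc'.1.symm he.1.1.symm n1) (isType hc'.2.symm he'.1.2.symm n2)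
      (isType hc'.1.symm he'.1.1.symm n2) (isType hc'.2.symm he.1.2.symm n1)
      (by rw [← he.2, ← he'.2]; unfold tri; abel)
    rcases this with ⟨h, _⟩ | ⟨h, _⟩
    · exact tri_cancel h
    · rw [← he.2, tri_eq_iff] at h
      grind
  -- By `step`, the colors seen from `a` and `c'` form the same unordered pair at all points of `E`.
  -- If they differ at one point they differ on all of `E`, against `not_four_of_not_split`.
  have step2 : ∀ c', (c' ≠ a ∧ c' ≠ b) → c' ∉ E → ∀ e ∈ E, col a e = col c' e := by
    intro c' hc' hc'E e he
    by_contra hne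
    have hall : ∀ e' ∈ E, col a e' ≠ col c' e' := by
      intro e' he'
      rcases step c' hc' hc'E e he e' he' with ⟨h, h'⟩ | ⟨h, h'⟩
      · rwa [← h, ← h']
      · rw [← h, ← h']; exact fun hh => hne hh.symm
    obtain ⟨c₁, h₁, c₂, h₂, c₃, h₃, c₄, h₄, h12, h13, h14, h23, h24, h34⟩ :=
      exists_four_of_card hE4
    have hq : ∀ e' ∈ E, e' ≠ a ∧ e' ≠ c' := fun e' he' =>
      ⟨((hmem e').1 he').1.1, fun h => hc'E (h ▸ he')⟩
    exact D.not_four_of_not_split hX hc'.1.symm (hns a c') (hq _ h₁) (hq _ h₂) (hq _ h₃) (hq _ h₄)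
      h12 h13 h14 h23 h24 h34 (hall _ h₁) (hall _ h₂) (hall _ h₃) (hall _ h₄)
  obtain ⟨e₀, he₀⟩ : E.Nonempty := Finset.card_pos.1 (by omega)
  refine ⟨E, col a e₀, hE4, by simp [hmem], by simp [hmem], hcE, ?_⟩
  have hau : ∀ e ∈ E, col a e = col a e₀ := by
    intro e he
    have h1 := step c ⟨hca, hcb⟩ hcE e he e₀ he₀
    have h2 := step2 c ⟨hca, hcb⟩ hcE e he
    have h3 := step2 c ⟨hca, hcb⟩ hcE e₀ he₀
    grind
  intro x hx e he
  by_cases hxa : x = a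
  · rw [hxa]; exact hau e he
  by_cases hxb : x = b
  · rw [hxb, ← ((hmem e).1 he).2]; exact hau e he
  · rw [← step2 x ⟨hxa, hxb⟩ hx e he]; exact hau e he

/-- Once a triangle of type `uuu` exists, `two_edges_of_cone` handles triples inside `E` and triples
outside it, while mixed triples are immediate from the join. -/
theorem matching_of_not_split (D : DualWeights col) [Fintype X] (hX : 9 ≤ Fintype.card X)
    (hns : ∀ a b, ¬ Split col a b) :
    ∃ u, ∀ x y z, x ≠ y → x ≠ z → y ≠ z → col x y = u ∨ col x z = u := by
  classical
  by_cases hm : ∀ x y z, x ≠ y → x ≠ z → y ≠ z → col x y = col x z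
  · obtain ⟨p⟩ : Nonempty X := Fintype.card_pos_iff.1 (by omega)
    obtain ⟨q, hq⟩ : ∃ q, q ≠ p := Fintype.exists_ne_of_one_lt_card (by omega) p
    refine ⟨col p q, fun x y z hxy hxz hyz => Or.inl ?_⟩
    have hp : ∀ x, x ≠ p → col p x = col p q := by
      intro x hx
      by_cases h : x = q
      · rw [h]
      · exact hm p x q hx.symm hq.symm h
    by_cases h1 : x = p
    · rw [h1]; exact hp y (h1 ▸ hxy.symm)
    by_cases h2 : y = p
    · rw [h2, D.symm]; exact hp x h1
    · rw [hm x y p hxy h1 h2, D.symm]; exact hp x h1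
  push Not at hm
  obtain ⟨c, a, b, hca, hcb, hab, hc⟩ := hm
  obtain ⟨E, u, hE4, haE, hbE, hcE, hu⟩ := D.join_of_not_split hX hns hab hca hcb hc
  have hne : ∀ x ∉ E, ∀ e ∈ E, x ≠ e := fun x hx e he h => hx (h ▸ he)
  obtain ⟨e₁, he₁, e₂, he₂, e₃, he₃, -, -, h12, h13, -, h23, -, -⟩ := exists_four_of_card hE4
  have huuu : IsType col (tri u u u) := by
    -- Otherwise no edge outside `E` has color `u`. In an octahedron with opposite faces outside and
    -- inside `E`, the mixed faces compared contain `u`, so the two opposite faces share a type. One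
    -- side has at least five points, and `eq_of_types_eq` makes its edges at a vertex equal in
    -- color. This contradicts `hc`, directly or through the common type.
    by_contra hno
    have hA : ∀ x ∉ E, ∀ y ∉ E, x ≠ y → col x y ≠ u := by
      intro x hx y hy hxy h
      apply hno
      have := isType (col := col) hxy (hne x hx e₁ he₁) (hne y hy e₁ he₁)
      rwa [h, hu x hx e₁ he₁, hu y hy e₁ he₁] at this
    have hEA : ∀ x ∉ E, ∀ y ∉ E, ∀ z ∉ E, x ≠ y → x ≠ z → y ≠ z → ∀ x' ∈ E, ∀ y' ∈ E, ∀ z' ∈ E,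
        x' ≠ y' → x' ≠ z' → y' ≠ z' →
        tri (col x y) (col x z) (col y z) = tri (col x' y') (col x' z') (col y' z') := by
      intro x hx y hy z hz hxy hxz hyz x' hx' y' hy' z' hz' hxy' hxz' hyz'
      have := D.octahedron hxy (hne x hx y' hy') (hne y hy x' hx').symm hxy' hxz
        (hne x hx z' hz') (hne z hz x' hx').symm hxz' hyz (hne y hy z' hz')
        (hne z hz y' hy').symm hyz'
      rw [D.symm x' y, D.symm x' z, D.symm y' z, hu y hy x' hx', hu z hz x' hx', hu z hz y' hy',
        hu x hx y' hy', hu x hx z' hz', hu y hy z' hz'] at this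
      have n1 := hA x hx y hy hxy
      have n2 := hA x hx z hz hxz
      have n3 := hA y hy z hz hyz
      rcases this with h | h | h | h
      · rw [tri_eq_iff] at h; grind
      · rw [tri_eq_iff] at h; grind
      · rw [tri_eq_iff] at h; grind
      · exact h
    have hcard : 5 ≤ Eᶜ.card ∨ 5 ≤ E.card := by
      rw [Finset.card_compl]; omega
    rcases hcard with h5 | h5
    · refine hc (eq_of_types_eq h5 (t := tri (col e₁ e₂) (col e₁ e₃) (col e₂ e₃)) ?_
        (Finset.mem_compl.2 hcE) (Finset.mem_compl.2 haE) (Finset.mem_compl.2 hbE) hca hcb)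
      intro x hx y hy z hz hxy hxz hyz
      rw [Finset.mem_compl] at hx hy hz
      exact hEA x hx y hy z hz hxy hxz hyz e₁ he₁ e₂ he₂ e₃ he₃ h12 h13 h23
    · have key : ∀ x ∈ E, ∀ y ∈ E, ∀ z ∈ E, x ≠ y → x ≠ z → col x y = col x z := by
        intro x hx y hy z hz hxy hxz
        refine eq_of_types_eq h5 (t := tri (col c a) (col c b) (col a b)) ?_ hx hy hz hxy hxz
        intro x hx y hy z hz hxy hxz hyz
        exact (hEA c hcE a haE b hbE hca hcb hab x hx y hy z hz hxy hxz hyz).symm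
      have k1 := key e₁ he₁ e₂ he₂ e₃ he₃ h12 h13
      have k2 := key e₂ he₂ e₁ he₁ e₃ he₃ h12.symm h23
      rw [D.symm] at k2
      have := hEA c hcE a haE b hbE hca hcb hab e₁ he₁ e₂ he₂ e₃ he₃ h12 h13 h23
      rw [← k1, ← k2, tri_eq_iff] at this
      grind
  refine ⟨u, fun x y z hxy hxz hyz => ?_⟩
  by_cases hx : x ∈ E
  · by_cases hy : y ∈ E
    · by_cases hz : z ∈ E
      · refine D.two_edges_of_cone huuu hxy hxz hyz (hne a haE x hx).symm (hne a haE y hy).symm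
          (hne a haE z hz).symm ?_ ?_ ?_ <;> rw [D.symm]
        exacts [hu a haE x hx, hu a haE y hy, hu a haE z hz]
      · right; rw [D.symm]; exact hu z hz x hx
    · left; rw [D.symm]; exact hu y hy x hx
  · by_cases hy : y ∈ E
    · exact Or.inl (hu x hx y hy)
    · by_cases hz : z ∈ E
      · exact Or.inr (hu x hx z hz)
      · exact D.two_edges_of_cone huuu hxy hxz hyz (hne x hx e₁ he₁) (hne y hy e₁ he₁)
          (hne z hz e₁ he₁) (hu x hx e₁ he₁) (hu y hy e₁ he₁) (hu z hz e₁ he₁)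

end DualWeights
-- Cones over monochromatic triangles
namespace DualWeights
variable {X C : Type*} {col : X → X → C}

/-- `s₁`, `s₂`, `s₃` form a triangle of color `γ` which `y` sees in the color `α ≠ γ`. -/
structure Cone (col : X → X → C) (s₁ s₂ s₃ y : X) (α γ : C) : Prop where
  h₁₂ : s₁ ≠ s₂
  h₁₃ : s₁ ≠ s₃
  h₂₃ : s₂ ≠ s₃
  y₁ : y ≠ s₁
  y₂ : y ≠ s₂
  y₃ : y ≠ s₃
  c₁₂ : col s₁ s₂ = γ
  c₁₃ : col s₁ s₃ = γ
  c₂₃ : col s₂ s₃ = γ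
  a₁ : col y s₁ = α
  a₂ : col y s₂ = α
  a₃ : col y s₃ = α
  ne : α ≠ γ

theorem Cone.swap (D : DualWeights col) {s₁ s₂ s₃ y : X} {α γ : C}
    (K : Cone col s₁ s₂ s₃ y α γ) : Cone col s₂ s₁ s₃ y α γ :=
  ⟨K.h₁₂.symm, K.h₂₃, K.h₁₃, K.y₂, K.y₁, K.y₃, by rw [D.symm, K.c₁₂], K.c₂₃, K.c₁₃,
    K.a₂, K.a₁, K.a₃, K.ne⟩

theorem Cone.rotate (D : DualWeights col) {s₁ s₂ s₃ y : X} {α γ : C}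
    (K : Cone col s₁ s₂ s₃ y α γ) : Cone col s₃ s₁ s₂ y α γ :=
  ⟨K.h₁₃.symm, K.h₂₃.symm, K.h₁₂, K.y₃, K.y₁, K.y₂, by rw [D.symm, K.c₁₃],
    by rw [D.symm, K.c₂₃], K.c₁₂, K.a₃, K.a₁, K.a₂, K.ne⟩

theorem Cone.mono {s₁ s₂ s₃ y : X} {α γ : C}
    (K : Cone col s₁ s₂ s₃ y α γ) : IsType col (tri γ γ γ) := by
  have := isType (col := col) K.h₁₂ K.h₁₃ K.h₂₃
  rwa [K.c₁₂, K.c₁₃, K.c₂₃] at this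

/-- If `x` distinguishes `s₂` from `s₃`, then it has the color of `y` at `s₁`. -/
theorem Cone.of_ne (D : DualWeights col) {s₁ s₂ s₃ y x : X} {α γ : C}
    (K : Cone col s₁ s₂ s₃ y α γ) (hxy : x ≠ y) (x₁ : x ≠ s₁) (x₂ : x ≠ s₂) (x₃ : x ≠ s₃)
    (h : col x s₂ ≠ col x s₃) : col x s₁ = α ∧ col x y = γ := by
  have := D.two (isType x₁ x₂ K.h₁₂) (isType hxy x₃ K.y₃) (isType x₁ x₃ K.h₁₃)
    (isType hxy x₂ K.y₂) (by rw [K.c₁₂, K.c₁₃, K.a₂, K.a₃]; unfold tri; abel)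
  rw [K.c₁₂, K.c₁₃, K.a₂, K.a₃] at this
  have hne := K.ne
  rcases this with ⟨h1, _⟩ | ⟨h1, _⟩
  · have := tri_cancel h1; grind
  · rw [tri_eq_iff] at h1; grind

/-- A further point sees the triangle uniformly, or in the color of `y` but for one point. -/
theorem Cone.sees (D : DualWeights col) {s₁ s₂ s₃ y x : X} {α γ : C}
    (K : Cone col s₁ s₂ s₃ y α γ) (hxy : x ≠ y) (x₁ : x ≠ s₁) (x₂ : x ≠ s₂) (x₃ : x ≠ s₃) :
    (col x s₂ = col x s₁ ∧ col x s₃ = col x s₁) ∨ (col x s₁ = α ∧ col x s₂ = α) ∨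
      (col x s₁ = α ∧ col x s₃ = α) ∨ (col x s₂ = α ∧ col x s₃ = α) := by
  have h1 := K.of_ne D hxy x₁ x₂ x₃
  have h2 := (K.swap D).of_ne D hxy x₂ x₁ x₃
  have h3 := (K.rotate D).of_ne D hxy x₃ x₁ x₂
  grind

/-- Two points seeing the triangle in its own color are joined by that color. -/
theorem Cone.clique (D : DualWeights col) {s₁ s₂ s₃ y x x' : X} {α γ : C}
    (K : Cone col s₁ s₂ s₃ y α γ) (hxy : x ≠ y) (hxy' : x' ≠ y) (hxx' : x ≠ x')
    (x₁ : x ≠ s₁) (x₁' : x' ≠ s₁) (hx : col x s₁ = γ) (hx' : col x' s₁ = γ) :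
    col x x' = γ := by
  have T₁ : IsType col (tri α α γ) := by
    have := isType (col := col) K.y₁ K.y₂ K.h₁₂
    rwa [K.a₁, K.a₂, K.c₁₂] at this
  -- The other side consists of `x x' y`, `γγγ` and `ααγ`. Two triangles on this side contain `α`,
  -- so the one on `x`, `x'`, `s₁` is of type `γγγ`.
  have h := D.three (isType hxx' x₁ x₁') (isType hxy x₁ K.y₁) (isType hxy' x₁' K.y₁)
    (isType hxx' hxy hxy') K.mono T₁ (by rw [hx, hx', K.a₁]; unfold tri; abel)
  have hne := K.ne
  simp only [hx, hx', K.a₁, tri_eq_iff] at h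
  grind

/-- Two points seeing a triangle in different colors, both distinct from the color of the triangle,
force the single edge form. -/
theorem single_edge_of_cones (D : DualWeights col) {s₁ s₂ s₃ y z : X} {α β γ : C}
    (K : Cone col s₁ s₂ s₃ y α γ) (J : Cone col s₁ s₂ s₃ z β γ) (hαβ : α ≠ β) :
    y ≠ z ∧ ∀ x, x ≠ y → x ≠ z → col y x = α ∧ col z x = β ∧
      ∀ x', x' ≠ y → x' ≠ z → x ≠ x' → col x x' = γ := by
  have hyz : y ≠ z := by
    rintro rfl; exact hαβ (K.a₁.symm.trans J.a₁)
  have K₁ := K.ne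
  have J₁ := J.ne
  have far : ∀ x, x ≠ y → x ≠ z → x ≠ s₁ → x ≠ s₂ → x ≠ s₃ →
      col x s₁ = γ ∧ col x s₂ = γ ∧ col x s₃ = γ ∧ col x y = α ∧ col x z = β := by
    intro x hy hz x₁ x₂ x₃
    have hu : col x s₂ = col x s₁ ∧ col x s₃ = col x s₁ := by
      have h1 := K.sees D hy x₁ x₂ x₃
      have h2 := J.sees D hz x₁ x₂ x₃
      grind
    -- One octahedron with opposite pairs `s₁, x`, `s₂, y`, `s₃, z`, read from the faces of types
    -- `γγγ`, `ααγ` and `ββγ`.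
    have o0 := D.octahedron (x := s₁) (x' := x) (y := s₂) (y' := y) (z := s₃) (z' := z)
      K.h₁₂ K.y₁.symm x₂ hy K.h₁₃ J.y₁.symm x₃ hz K.h₂₃ J.y₂.symm K.y₃ hyz
    have o1 := D.octahedron (x := s₁) (x' := x) (y := y) (y' := s₂) (z := s₃) (z' := z)
      K.y₁.symm K.h₁₂ hy x₂ K.h₁₃ J.y₁.symm x₃ hz K.y₃ hyz K.h₂₃ J.y₂.symm
    have o2 := D.octahedron (x := s₁) (x' := x) (y := s₂) (y' := y) (z := z) (z' := s₃)
      K.h₁₂ K.y₁.symm x₂ hy J.y₁.symm K.h₁₃ hz x₃ J.y₂.symm K.h₂₃ hyz K.y₃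
    simp only [D.symm s₁ y, D.symm s₁ z, D.symm s₂ z, K.c₁₂, K.c₁₃, K.c₂₃, K.a₁,
      K.a₃, J.a₁, J.a₂, hu.1, hu.2, tri_eq_iff] at o0 o1 o2
    have hα : col x s₁ = γ := by
      by_contra hne
      grind
    grind
  have hS : ∀ x, x ≠ y → x ≠ z → (x = s₁ ∨ x = s₂ ∨ x = s₃ ∨
      (x ≠ s₁ ∧ x ≠ s₂ ∧ x ≠ s₃) ∧ col x s₁ = γ ∧ col x s₂ = γ ∧ col x s₃ = γ) ∧
      col y x = α ∧ col z x = β := by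
    intro x hy hz
    by_cases x₁ : x = s₁
    · subst x₁; exact ⟨Or.inl rfl, K.a₁, J.a₁⟩
    by_cases x₂ : x = s₂
    · subst x₂; exact ⟨Or.inr (Or.inl rfl), K.a₂, J.a₂⟩
    by_cases x₃ : x = s₃
    · subst x₃; exact ⟨Or.inr (Or.inr (Or.inl rfl)), K.a₃, J.a₃⟩
    obtain ⟨f₁, f₂, f₃, f₄, f₅⟩ := far x hy hz x₁ x₂ x₃
    exact ⟨Or.inr (Or.inr (Or.inr ⟨⟨x₁, x₂, x₃⟩, f₁, f₂, f₃⟩)), by rw [D.symm, f₄],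
      by rw [D.symm, f₅]⟩
  refine ⟨hyz, fun x hy hz => ⟨(hS x hy hz).2.1, (hS x hy hz).2.2, fun x' hy' hz' hxx' => ?_⟩⟩
  have e₁ := (hS x hy hz).1
  have e₂ := (hS x' hy' hz').1
  have b₁₂ := K.c₁₂
  have b₁₃ := K.c₁₃
  have b₂₃ := K.c₂₃
  have symm := D.symm
  rcases e₁ with e₁ | e₁ | e₁ | ⟨⟨k₁, k₂, k₃⟩, f₁, f₂, f₃⟩ <;>
    rcases e₂ with e₂ | e₂ | e₂ | ⟨⟨k₁', k₂', k₃'⟩, f₁', f₂', f₃'⟩ <;>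
    first
    | exact K.clique D hy hy' hxx' k₁ k₁' f₁ f₁'
    | grind

/-- The structure underlying the two clique form. -/
theorem two_cliques_of_cone (D : DualWeights col) {s₁ s₂ s₃ y : X} {α γ : C}
    (K : Cone col s₁ s₂ s₃ y α γ) (hno : ∀ x β, Cone col s₁ s₂ s₃ x β γ → β = α)
    (h4 : ∀ p q s, ∃ x x', x ≠ x' ∧ col x x' ≠ p ∧ col x x' ≠ q ∧ col x x' ≠ s) :
    ∃ Y : Set X, Y.Nonempty ∧ Yᶜ.Nonempty ∧
      (∀ x ∈ Y, ∀ x' ∈ Y, x ≠ x' → col x x' = γ) ∧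
      (∀ x ∉ Y, ∀ x' ∉ Y, x ≠ x' → col x x' = γ) ∧
      (∀ x ∉ Y, ∀ w ∈ Y, col x w ≠ γ) ∧
      (∀ x ∉ Y, ∀ w ∈ Y, ∀ w' ∈ Y, w ≠ w' → col x w = α ∨ col x w' = α) ∧
      (∀ w ∈ Y, ∀ x ∉ Y, ∀ x' ∉ Y, x ≠ x' → col x w = α ∨ col x' w = α) := by
  classical
  have hne := K.ne
  have hsymm := D.symm
  set Y : Set X := {x | x = s₁ ∨ x = s₂ ∨ x = s₃ ∨
    (x ≠ s₁ ∧ x ≠ s₂ ∧ x ≠ s₃) ∧ col x s₁ = γ ∧ col x s₂ = γ ∧ col x s₃ = γ}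
  have m₁ : s₁ ∈ Y := Or.inl rfl
  have m₂ : s₂ ∈ Y := Or.inr (Or.inl rfl)
  have m₃ : s₃ ∈ Y := Or.inr (Or.inr (Or.inl rfl))
  have hyY : y ∉ Y := by
    rintro (h | h | h | ⟨-, h, -⟩)
    exacts [K.y₁ h, K.y₂ h, K.y₃ h, hne (K.a₁.symm.trans h)]
  have hYY : ∀ x ∈ Y, ∀ x' ∈ Y, x ≠ x' → col x x' = γ := by
    intro x hx x' hx' hxx'
    have hy : x ≠ y := fun h => hyY (h ▸ hx)
    have hy' : x' ≠ y := fun h => hyY (h ▸ hx')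
    have b₁₂ := K.c₁₂
    have b₁₃ := K.c₁₃
    have b₂₃ := K.c₂₃
    rcases hx with e₁ | e₁ | e₁ | ⟨⟨k₁, k₂, k₃⟩, f₁, f₂, f₃⟩ <;>
      rcases hx' with e₂ | e₂ | e₂ | ⟨⟨k₁', k₂', k₃'⟩, f₁', f₂', f₃'⟩ <;>
      first
      | exact K.clique D hy hy' hxx' k₁ k₁' f₁ f₁'
      | grind
  -- A point outside `Y` that sees the triangle uniformly does so in a color other than `γ`, hence
  -- in `α` by `hno`.
  have hsee : ∀ x ∉ Y, ∃ s ∈ Y, ∃ s' ∈ Y, ∃ s'' ∈ Y, s ≠ s' ∧ s ≠ s'' ∧ s' ≠ s'' ∧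
      col x s = α ∧ col x s' = α := by
    intro x hx
    have x₁ : x ≠ s₁ := fun h => hx (h ▸ m₁)
    have x₂ : x ≠ s₂ := fun h => hx (h ▸ m₂)
    have x₃ : x ≠ s₃ := fun h => hx (h ▸ m₃)
    have hor : (col x s₁ = α ∧ col x s₂ = α) ∨ (col x s₁ = α ∧ col x s₃ = α) ∨
        (col x s₂ = α ∧ col x s₃ = α) := by
      by_cases hxy : x = y
      · rw [hxy]; exact Or.inl ⟨K.a₁, K.a₂⟩
      rcases K.sees D hxy x₁ x₂ x₃ with ⟨h₂, h₃⟩ | h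
      · by_cases hγ : col x s₁ = γ
        · exact absurd (Or.inr (Or.inr (Or.inr ⟨⟨x₁, x₂, x₃⟩, hγ, h₂.trans hγ, h₃.trans hγ⟩))) hx
        · have := hno x (col x s₁) ⟨K.h₁₂, K.h₁₃, K.h₂₃, x₁, x₂, x₃, K.c₁₂, K.c₁₃, K.c₂₃, rfl,
            h₂, h₃, hγ⟩
          exact Or.inl ⟨this, h₂.trans this⟩
      · exact h
    rcases hor with h | h | h
    · exact ⟨s₁, m₁, s₂, m₂, s₃, m₃, K.h₁₂, K.h₁₃, K.h₂₃, h⟩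
    · exact ⟨s₁, m₁, s₃, m₃, s₂, m₂, K.h₁₃, K.h₁₂, K.h₂₃.symm, h⟩
    · exact ⟨s₂, m₂, s₃, m₃, s₁, m₁, K.h₂₃, K.h₁₂.symm, K.h₁₃.symm, h⟩
  clear_value Y
  have hd : ∀ x ∉ Y, ∀ w ∈ Y, x ≠ w := fun x hx w hw h => hx (h ▸ hw)
  have htwo : ∀ w, ∃ s ∈ Y, ∃ s' ∈ Y, s ≠ s' ∧ s ≠ w ∧ s' ≠ w := by
    intro w
    have := K.h₁₂
    have := K.h₁₃
    have := K.h₂₃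
    by_cases h₁ : s₁ = w
    · exact ⟨s₂, m₂, s₃, m₃, by grind⟩
    by_cases h₂ : s₂ = w
    · exact ⟨s₁, m₁, s₃, m₃, by grind⟩
    · exact ⟨s₁, m₁, s₂, m₂, by grind⟩
  have hone : ∀ x ∉ Y, ∀ w ∈ Y, ∀ w' ∈ Y, w ≠ w' → col x w = α ∨ col x w' = α := by
    intro x hx w hw w' hw' hww'
    by_contra! hcon
    obtain ⟨s, hs, s', hs', -, -, hss', -, -, a, a'⟩ := hsee x hx
    have n₁ : w ≠ s := by rintro rfl; exact hcon.1 a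
    have n₂ : w ≠ s' := by rintro rfl; exact hcon.1 a'
    have n₃ : w' ≠ s := by rintro rfl; exact hcon.2 a
    have n₄ : w' ≠ s' := by rintro rfl; exact hcon.2 a'
    have := D.two (isType (hd x hx w hw) (hd x hx s hs) n₁)
      (isType (hd x hx w' hw') (hd x hx s' hs') n₄) (isType (hd x hx s hs) (hd x hx s' hs') hss')
      (isType (hd x hx w hw) (hd x hx w' hw') hww')
      (by rw [hYY w hw s hs n₁, hYY w' hw' s' hs' n₄, hYY s hs s' hs' hss', hYY w hw w' hw' hww']
          unfold tri; abel)
    simp only [a, a', hYY w hw s hs n₁, hYY w' hw' s' hs' n₄, hYY s hs s' hs' hss',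
      hYY w hw w' hw' hww', tri_eq_iff] at this
    grind
  have hcross : ∀ x ∉ Y, ∀ w ∈ Y, col x w ≠ γ := by
    intro x hx w hw h
    obtain ⟨s, hs, s', hs', -, -, hss', -, -, a, a'⟩ := hsee x hx
    have n₁ : w ≠ s := by rintro rfl; exact hne (a.symm.trans h)
    have n₂ : w ≠ s' := by rintro rfl; exact hne (a'.symm.trans h)
    have := D.two (isType n₁ n₂ hss')
      (isType (hd x hx s hs) (hd x hx s' hs') hss') (isType (hd x hx w hw) (hd x hx s hs) n₁)
      (isType (hd x hx w hw) (hd x hx s' hs') n₂)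
      (by rw [h, a, a', hYY w hw s hs n₁, hYY w hw s' hs' n₂, hYY s hs s' hs' hss']
          unfold tri; abel)
    simp only [h, a, a', hYY w hw s hs n₁, hYY w hw s' hs' n₂, hYY s hs s' hs' hss',
      tri_eq_iff] at this
    grind
  have hother : ∀ w ∈ Y, ∀ x ∉ Y, ∀ x' ∉ Y, x ≠ x' → col x w = α ∨ col x' w = α := by
    intro w hw x hx x' hx' hxx'
    by_contra! hcon
    obtain ⟨s, hs, s', hs', hss', n₁, n₂⟩ := htwo w
    have a := (hone x hx s hs w hw n₁).resolve_right hcon.1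
    have a' := (hone x hx s' hs' w hw n₂).resolve_right hcon.1
    have b := (hone x' hx' s hs w hw n₁).resolve_right hcon.2
    have b' := (hone x' hx' s' hs' w hw n₂).resolve_right hcon.2
    have := D.three (isType (hd x hx w hw) (hd x hx s hs) n₁.symm)
      (isType (hd x' hx' w hw) (hd x' hx' s' hs') n₂.symm)
      (isType hxx' (hd x hx s hs) (hd x' hx' s hs))
      (isType hxx' (hd x hx w hw) (hd x' hx' w hw))
      (isType (hd x hx s hs) (hd x hx s' hs') hss') (isType (hd x' hx' s hs) (hd x' hx' s' hs') hss')
      (by rw [a, a', b, b', hYY w hw s hs n₁.symm, hYY w hw s' hs' n₂.symm, hYY s hs s' hs' hss']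
          unfold tri; abel)
    simp only [a, a', b, b', hYY w hw s hs n₁.symm, hYY w hw s' hs' n₂.symm,
      hYY s hs s' hs' hss', tri_eq_iff] at this
    grind
  have hexc : ∀ x ∉ Y, ∀ x' ∉ Y, x ≠ x' → ∀ w ∈ Y, col x w ≠ α → col x x' = γ := by
    intro x hx x' hx' hxx' w hw hxw
    have hw' := (hother w hw x hx x' hx' hxx').resolve_left hxw
    have key : ∀ s ∈ Y, ∀ s' ∈ Y, s ≠ s' → s ≠ w → s' ≠ w → col x' s = α → col x x' = γ := by
      intro s hs s' hs' hss' n₁ n₂ b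
      have a := (hone x hx s hs w hw n₁).resolve_right hxw
      have a' := (hone x hx s' hs' w hw n₂).resolve_right hxw
      have := D.two (isType hxx' (hd x hx w hw) (hd x' hx' w hw))
        (isType (hd x hx s hs) (hd x hx s' hs') hss') (isType (hd x hx w hw) (hd x hx s hs) n₁.symm)
        (isType hxx' (hd x hx s hs) (hd x' hx' s hs))
        (by rw [a, a', b, hw', hYY w hw s hs n₁.symm, hYY s hs s' hs' hss']
            unfold tri; abel)
      simp only [a, a', b, hw', hYY w hw s hs n₁.symm, hYY s hs s' hs' hss', tri_eq_iff] at this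
      grind
    obtain ⟨s, hs, s', hs', hss', n₁, n₂⟩ := htwo w
    rcases hone x' hx' s hs s' hs' hss' with b | b
    · exact key s hs s' hs' hss' n₁ n₂ b
    · exact key s' hs' s hs hss'.symm n₂ n₁ b
  refine ⟨Y, ⟨s₁, m₁⟩, ⟨y, hyY⟩, hYY, ?_, hcross, hone, hother⟩
  intro x hx x' hx' hxx'
  by_contra hρ
  have ax : ∀ w ∈ Y, col x w = α := by
    intro w hw; by_contra h; exact hρ (hexc x hx x' hx' hxx' w hw h)
  have ax' : ∀ w ∈ Y, col x' w = α := by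
    intro w hw; by_contra h; exact hρ (by rw [hsymm]; exact hexc x' hx' x hx hxx'.symm w hw h)
  -- By `hexc`, both points now see all of `Y` in `α`. A third point outside `Y` gives a
  -- contradictory octahedron; without one, only `α`, `γ` and `col x x'` occur, against the fourth
  -- color.
  by_cases hthird : ∃ z ∉ Y, x ≠ z ∧ x' ≠ z
  · obtain ⟨z, hz, hxz, hxz'⟩ := hthird
    obtain ⟨s, hs, s', hs', s'', hs'', h12, h13, h23, a, a'⟩ := hsee z hz
    have o := D.octahedron (x := s) (x' := x) (y := s') (y' := x') (z := s'') (z' := z)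
      h12 (hd x' hx' s hs).symm (hd x hx s' hs') hxx' h13 (hd z hz s hs).symm (hd x hx s'' hs'')
      hxz h23 (hd z hz s' hs').symm (hd x' hx' s'' hs'') hxz'
    simp only [hsymm s x', hsymm s z, hsymm s' z, hYY s hs s' hs' h12, hYY s hs s'' hs'' h13,
      hYY s' hs' s'' hs'' h23, ax _ hs', ax _ hs'', ax' _ hs, ax' _ hs'', a, a', tri_eq_iff] at o
    grind
  · push Not at hthird
    obtain ⟨p, q, hpq, c₁, c₂, c₃⟩ := h4 α γ (col x x')
    by_cases hp : p ∈ Y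
    · by_cases hq : q ∈ Y
      · exact c₂ (hYY p hp q hq hpq)
      · apply c₁
        rw [hsymm]
        by_cases e : x = q
        · rw [← e]; exact ax p hp
        · rw [← hthird q hq e]; exact ax' p hp
    · by_cases hq : q ∈ Y
      · apply c₁
        by_cases e : x = p
        · rw [← e]; exact ax q hq
        · rw [← hthird p hp e]; exact ax' q hq
      · apply c₃
        by_cases e : x = p
        · rw [← e, ← hthird q hq fun e' => hpq (e.symm.trans e')]
        · rw [← hthird p hp e, hsymm]
          by_cases e' : x = q
          · rw [e']
          · exact absurd ((hthird p hp e).symm.trans (hthird q hq e')) hpq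

/-- Exchanges make the triangle `c d e` monochromatic. As `a` and `b` see it in distinct colors, at
least one of these differs from its own color. -/
theorem exists_cone_of_split (D : DualWeights col) {a b : X} (h : Split col a b) :
    ∃ s₁ s₂ s₃ y α γ, Cone col s₁ s₂ s₃ y α γ := by
  obtain ⟨hab, c, d, e, hcd, hce, hde, hc, hd, he, ad, ae, bd, be, hne⟩ := h
  have key : ∀ c d e : X, c ≠ d → c ≠ e → d ≠ e → (c ≠ a ∧ c ≠ b) → (d ≠ a ∧ d ≠ b) →
      (e ≠ a ∧ e ≠ b) → col a d = col a c → col a e = col a c → col b d = col b c →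
      col b e = col b c → col a c ≠ col b c → col c d = col c e := by
    intro c d e hcd hce hde hc hd he ad ae bd be hne
    have := D.two (isType hc.1.symm hd.1.symm hcd) (isType hc.2.symm he.2.symm hce)
      (isType hc.1.symm he.1.symm hce) (isType hc.2.symm hd.2.symm hcd)
      (by rw [ad, ae, bd, be]; unfold tri; abel)
    simp only [ad, ae, bd, be, tri_eq_iff] at this
    grind
  have k₁ := key c d e hcd hce hde hc hd he ad ae bd be hne
  have k₂ := key d c e hcd.symm hde hce hd hc he ad.symm (ae.trans ad.symm) bd.symm
    (be.trans bd.symm) (by rwa [ad, bd])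
  rw [D.symm] at k₂
  by_cases hα : col a c = col c d
  · exact ⟨c, d, e, b, col b c, col c d, hcd, hce, hde, hc.2.symm, hd.2.symm, he.2.symm, rfl,
      k₁.symm, k₂.symm, rfl, bd, be, fun h => hne (hα.trans h.symm)⟩
  · exact ⟨c, d, e, a, col a c, col c d, hcd, hce, hde, hc.1.symm, hd.1.symm, he.1.symm, rfl,
      k₁.symm, k₂.symm, rfl, ad, ae, hα⟩

/-- The classification in terms of a symmetric color function. -/
theorem trichotomy (D : DualWeights col) [Fintype X] (hX : 9 ≤ Fintype.card X)
    (h4 : ∀ p q s, ∃ x x', x ≠ x' ∧ col x x' ≠ p ∧ col x x' ≠ q ∧ col x x' ≠ s) :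
    (∃ u, ∀ x y z, x ≠ y → x ≠ z → y ≠ z → col x y = u ∨ col x z = u) ∨
    (∃ (α γ : C) (Y : Set X), Y.Nonempty ∧ Yᶜ.Nonempty ∧ α ≠ γ ∧
      (∀ x ∈ Y, ∀ x' ∈ Y, x ≠ x' → col x x' = γ) ∧
      (∀ x ∉ Y, ∀ x' ∉ Y, x ≠ x' → col x x' = γ) ∧
      (∀ x ∉ Y, ∀ w ∈ Y, col x w ≠ γ) ∧
      (∀ x ∉ Y, ∀ w ∈ Y, ∀ w' ∈ Y, w ≠ w' → col x w = α ∨ col x w' = α) ∧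
      (∀ w ∈ Y, ∀ x ∉ Y, ∀ x' ∉ Y, x ≠ x' → col x w = α ∨ col x' w = α)) ∨
    ∃ (α β γ : C) (y z : X), y ≠ z ∧ ∀ x, x ≠ y → x ≠ z → col y x = α ∧ col z x = β ∧
      ∀ x', x' ≠ y → x' ≠ z → x ≠ x' → col x x' = γ := by
  by_cases hs : ∃ a b, Split col a b
  · obtain ⟨a, b, hab⟩ := hs
    obtain ⟨s₁, s₂, s₃, y, α, γ, K⟩ := D.exists_cone_of_split hab
    by_cases hno : ∀ x β, Cone col s₁ s₂ s₃ x β γ → β = α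
    · obtain ⟨Y, h₁, h₂, h⟩ := D.two_cliques_of_cone K hno h4
      exact Or.inr (Or.inl ⟨α, γ, Y, h₁, h₂, K.ne, h⟩)
    · push Not at hno
      obtain ⟨z, β, J, hβ⟩ := hno
      exact Or.inr (Or.inr ⟨α, β, γ, y, z, D.single_edge_of_cones K J hβ.symm⟩)
  · push Not at hs
    exact Or.inl (D.matching_of_not_split hX hs)

end DualWeights

/-! ### Linear algebra: existence of dual weights -/

/-- The colors of the edges. -/
def colorSet {X C : Type*} (col : X → X → C) : Set C := {p | ∃ x y, x ≠ y ∧ col x y = p}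

/-- The linear map taking a weight on the colors to the induced weights of the triangle types. -/
noncomputable def typeSum {X C : Type*} (col : X → X → C) :
    (colorSet col → ℚ) →ₗ[ℚ] ({t // IsType col t} → ℚ) where
  toFun v t := (t.1.map (Function.ExtendByZero.linearMap ℚ Subtype.val v)).sum
  map_add' v v' := by
    ext t
    simp only [map_add, Pi.add_apply, Multiset.sum_map_add]
  map_smul' c v := by
    ext t
    simp only [map_smul, Pi.smul_apply, smul_eq_mul, Multiset.sum_map_mul_left, RingHom.id_apply]

section
variable {X C : Type*} {col : X → X → C}

theorem extend_color (v : colorSet col → ℚ) (p : colorSet col) :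
    Function.ExtendByZero.linearMap ℚ Subtype.val v p.1 = v p :=
  Subtype.val_injective.extend_apply v 0 p

theorem typeSum_apply (v : colorSet col → ℚ) {x y z : X} (hxy : x ≠ y) (hxz : x ≠ z)
    (hyz : y ≠ z) :
    typeSum col v ⟨_, DualWeights.isType hxy hxz hyz⟩ =
      v ⟨col x y, x, y, hxy, rfl⟩ + v ⟨col x z, x, z, hxz, rfl⟩ + v ⟨col y z, y, z, hyz, rfl⟩ := by
  rw [← extend_color v ⟨col x y, x, y, hxy, rfl⟩, ← extend_color v ⟨col x z, x, z, hxz, rfl⟩,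
    ← extend_color v ⟨col y z, y, z, hyz, rfl⟩]
  simp [typeSum, tri, add_assoc]

/-- On a weight in the kernel all triangle sums vanish, so it is constant at each vertex. The three
edges of a triangle then have equal weight, which is zero. -/
theorem typeSum_injective [Fintype X] (hX : 5 ≤ Fintype.card X) (hcol : ∀ x y, col x y = col y x) :
    Function.Injective (typeSum col) := by
  classical
  rw [← LinearMap.ker_eq_bot, LinearMap.ker_eq_bot']
  intro v hv
  have hsum : ∀ x y z, x ≠ y → x ≠ z → y ≠ z →
      Function.ExtendByZero.linearMap ℚ Subtype.val v (col x y) +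
      Function.ExtendByZero.linearMap ℚ Subtype.val v (col x z) +
      Function.ExtendByZero.linearMap ℚ Subtype.val v (col y z) = 0 := by
    intro x y z hxy hxz hyz
    have := typeSum_apply v hxy hxz hyz
    rw [hv] at this
    rw [extend_color v ⟨col x y, x, y, hxy, rfl⟩, extend_color v ⟨col x z, x, z, hxz, rfl⟩,
      extend_color v ⟨col y z, y, z, hyz, rfl⟩]
    exact this.symm
  set f : X → X → ℚ := fun x y => Function.ExtendByZero.linearMap ℚ Subtype.val v (col x y) with hf
  have hfsymm : ∀ x y, f x y = f y x := fun x y => by simp only [hf, hcol x y]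
  have hadj : ∀ a b e, a ≠ b → a ≠ e → b ≠ e → f a b = f a e := by
    intro a b e hab hae hbe
    obtain ⟨c, -, d, -, hcd, ⟨c1, c2, c3⟩, d1, d2, d3⟩ :=
      exists_two_others (F := Finset.univ) (by rwa [Finset.card_univ]) a b e
    exact eq_of_triangle_sum_eq (N := 0) (F := Set.univ)
      (fun x _ y _ z _ hxy hxz hyz => hsum x y z hxy hxz hyz)
      trivial trivial trivial trivial trivial hab c1.symm d1.symm hae c2.symm d2.symm c3 hcd d3
  ext ⟨p, x, y, hxy, rfl⟩
  obtain ⟨z, -, -, -, -, ⟨z1, z2, -⟩, -⟩ :=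
    exists_two_others (F := Finset.univ) (by rwa [Finset.card_univ]) x y y
  have h1 := hadj x y z hxy z1.symm z2.symm
  have h2 := hadj y x z hxy.symm z2.symm z1.symm
  have h3 := hfsymm x y
  have h4 : f x y + f x z + f y z = 0 := hsum x y z hxy z1.symm z2.symm
  have h5 : f x y = v ⟨col x y, x, y, hxy, rfl⟩ := extend_color v ⟨col x y, x, y, hxy, rfl⟩
  rw [Pi.zero_apply, ← h5]
  linarith

theorem finite_colorSet [Finite X] : (colorSet col).Finite := by
  refine (Set.finite_range fun e : X × X => col e.1 e.2).subset ?_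
  rintro _ ⟨x, y, -, rfl⟩
  exact ⟨(x, y), rfl⟩

theorem finite_types [Finite X] : {t | IsType col t}.Finite := by
  refine (Set.finite_range fun e : X × X × X =>
    tri (col e.1 e.2.1) (col e.1 e.2.2) (col e.2.1 e.2.2)).subset ?_
  rintro _ ⟨x, y, z, -, -, -, rfl⟩
  exact ⟨(x, y, z), rfl⟩

/-- If there are no more triangle types than colors, then dual weights exist. -/
theorem nonempty_dualWeights [Fintype X] (hX : 5 ≤ Fintype.card X)
    (hcol : ∀ x y, col x y = col y x)
    (hcard : {t | IsType col t}.ncard ≤ (colorSet col).ncard) : Nonempty (DualWeights col) := by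
  classical
  have : Fintype (colorSet col) := finite_colorSet.fintype
  have : Fintype {t // IsType col t} := (finite_types (col := col)).fintype
  have hinj := typeSum_injective hX hcol
  have hle := LinearMap.finrank_le_finrank_of_injective hinj
  have hdim : Module.finrank ℚ (colorSet col → ℚ) = Module.finrank ℚ ({t // IsType col t} → ℚ) := by
    refine le_antisymm hle ?_
    rw [Module.finrank_fintype_fun_eq_card, Module.finrank_fintype_fun_eq_card,
      ← Nat.card_eq_fintype_card, ← Nat.card_eq_fintype_card]
    exact hcard
  let e := LinearMap.linearEquivOfInjective (typeSum col) hinj hdim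
  have he : ∀ v, e v = typeSum col v := fun v => rfl
  let W : {t // IsType col t} → colorSet col → ℚ := fun t => e.symm (Pi.single t 1)
  have hW : ∀ t s, typeSum col (W t) s = Pi.single (M := fun _ => ℚ) t 1 s := by
    intro t s; rw [← he, LinearEquiv.apply_symm_apply]
  let w : Multiset C → C → ℚ := fun t =>
    if h : IsType col t then Function.ExtendByZero.linearMap ℚ Subtype.val (W ⟨t, h⟩) else 0
  have hw : ∀ (t : {t // IsType col t}) (p : colorSet col), w t.1 p.1 = W t p := by
    intro t p
    simp only [w, t.2, dif_pos, extend_color]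
  have hw' : ∀ s t : {t // IsType col t}, (s.1.map (w t.1)).sum =
      Pi.single (M := fun _ => ℚ) t 1 s := by
    intro s t
    rw [← hW t s]
    simp only [w, t.2, dif_pos, typeSum, LinearMap.coe_mk, AddHom.coe_mk]
  have hspan : ∀ (v : colorSet col → ℚ) p, v p = ∑ t, typeSum col v t * W t p := by
    intro v p
    have h1 : v = ∑ t, typeSum col v t • W t := by
      apply e.injective
      rw [map_sum]
      ext s
      simp only [map_smul, Finset.sum_apply, Pi.smul_apply, smul_eq_mul, he, hW]
      simp [Pi.single_apply]
    have h2 := congrFun h1 p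
    simpa only [Finset.sum_apply, Pi.smul_apply, smul_eq_mul] using h2
  refine ⟨⟨hcol, w, fun t ht => ?_, fun s t hs hst => ?_, fun x y x' y' hxy hxy' hle => ?_⟩⟩
  · rw [hw' ⟨t, ht⟩ ⟨t, ht⟩, Pi.single_eq_same]
  · by_cases ht : IsType col t
    · rw [hw' ⟨s, hs⟩ ⟨t, ht⟩, Pi.single_eq_of_ne]
      exact fun h => hst (congrArg Subtype.val h)
    · simp [w, ht]
  · let p : colorSet col := ⟨col x y, x, y, hxy, rfl⟩
    let q : colorSet col := ⟨col x' y', x', y', hxy', rfl⟩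
    have hle' : ∀ t ∈ (Finset.univ : Finset {t // IsType col t}), W t p ≤ W t q := by
      intro t _
      rw [← hw, ← hw]; exact hle t.1
    -- Expanding the constant 1/3 in the dual basis shows that the weights of every color sum to 1/3
    -- over the types. Inequality at every type thus forces equality, and then no weight separates
    -- `p` from `q`, not even the indicator of `p`.
    have hthird : ∀ t, typeSum col (fun _ => 1 / 3) t = 1 := by
      rintro ⟨_, a, b, c, hab, hac, hbc, rfl⟩
      rw [typeSum_apply _ hab hac hbc]; norm_num
    have hp := hspan (fun _ => 1 / 3) p
    have hq := hspan (fun _ => 1 / 3) q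
    simp only [hthird, one_mul] at hp hq
    have heq := (Finset.sum_eq_sum_iff_of_le hle').1 (hp.symm.trans hq)
    have h1 : (Pi.single p 1 : colorSet col → ℚ) p = (Pi.single p 1 : colorSet col → ℚ) q := by
      rw [hspan (Pi.single p 1) p, hspan (Pi.single p 1) q]
      exact Finset.sum_congr rfl fun t ht => by rw [heq t ht]
    by_contra hne
    have hqp : q ≠ p := fun h => hne (congrArg Subtype.val h).symm
    rw [Pi.single_eq_same, Pi.single_eq_of_ne hqp] at h1
    exact one_ne_zero h1

end

/-! ### From colorings of 2-subsets to color functions -/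

open Classical in
/-- The coloring as a function of two points, with a junk value on the diagonal. -/
noncomputable def edgeColor {X C : Type*} (r : Pair X → C) (U₀ : Pair X) (x y : X) : C :=
  if h : x ≠ y then r ⟨{x, y}, Finset.card_pair h⟩ else r U₀

section
variable {X C : Type*} {r : Pair X → C} {U₀ : Pair X}

theorem edgeColor_comm (x y : X) : edgeColor r U₀ x y = edgeColor r U₀ y x := by
  by_cases h : x = y
  · rw [h]
  · simp only [edgeColor, ne_eq, h, Ne.symm h, not_false_eq_true, dite_true]
    congr 1
    apply Subtype.ext
    ext
    simp [or_comm]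

theorem apply_eq_edgeColor [DecidableEq X] {U : Pair X} {x y : X} (hxy : x ≠ y)
    (hU : U.1 = {x, y}) : r U = edgeColor r U₀ x y := by
  simp only [edgeColor, ne_eq, hxy, not_false_eq_true, dite_true]
  congr 1
  apply Subtype.ext
  rw [hU]
  ext; simp

theorem exists_pair [DecidableEq X] (r : Pair X → C) (U₀ U : Pair X) :
    ∃ x y, x ≠ y ∧ U.1 = {x, y} ∧ r U = edgeColor r U₀ x y := by
  obtain ⟨x, y, hxy, h⟩ := Finset.card_eq_two.1 U.2
  have h' : U.1 = {x, y} := by rw [h]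
  exact ⟨x, y, hxy, h', apply_eq_edgeColor hxy h'⟩

theorem colorSet_edgeColor : colorSet (edgeColor r U₀) = Set.range r := by
  classical
  ext p
  constructor
  · rintro ⟨x, y, hxy, rfl⟩
    exact ⟨⟨{x, y}, Finset.card_pair hxy⟩, apply_eq_edgeColor hxy rfl⟩
  · rintro ⟨U, rfl⟩
    obtain ⟨x, y, hxy, -, h⟩ := exists_pair r U₀ U
    exact ⟨x, y, hxy, h.symm⟩

theorem isometric_iff_of_card_eq_two {Y Z : Finset X} (hY : Y.card = 2) :
    Isometric r Y Z ↔ ∃ hZ : Z.card = 2, r ⟨Z, hZ⟩ = r ⟨Y, hY⟩ := by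
  classical
  have huniv : ∀ {W : Finset X}, W.card = 2 → ∀ U : Pair W,
      U.map (Function.Embedding.subtype (fun x => x ∈ W)) = W := by
    intro W hW U
    have hU : U.1 = Finset.univ := by
      rw [← Finset.card_eq_iff_eq_univ, U.2, Fintype.card_coe, hW]
    change U.1.map _ = W
    rw [hU]
    exact Finset.attach_map_val
  constructor
  · rintro ⟨f, hf⟩
    have hZ : Z.card = 2 := by
      rw [← hY, ← Fintype.card_coe, ← Fintype.card_coe]; exact (Fintype.card_congr f).symm
    refine ⟨hZ, ?_⟩
    let U : Pair Y := ⟨Finset.univ, by rw [Finset.card_univ, Fintype.card_coe, hY]⟩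
    have h := congrFun hf U
    simp only [restrict, Function.comp_apply] at h
    convert h.symm using 2
    · exact Subtype.ext (huniv hZ _).symm
    · exact Subtype.ext (huniv hY _).symm
  · rintro ⟨hZ, h⟩
    refine ⟨Finset.equivOfCardEq (hY.trans hZ.symm), ?_⟩
    funext U
    simp only [restrict, Function.comp_apply]
    convert h.symm using 2
    · exact Subtype.ext (huniv hY _)
    · exact Subtype.ext (huniv hZ _)

theorem a_two_le [Finite X] (r : Pair X → C) : a 2 r ≤ (Set.range r).ncard := by
  have hfin : (Set.range r).Finite := Set.finite_range r
  refine le_trans (Set.ncard_le_ncard (t := (fun p => {Z | ∃ hZ : Z.card = 2, r ⟨Z, hZ⟩ = p}) ''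
    Set.range r) ?_ (hfin.image _)) (Set.ncard_image_le hfin)
  rintro _ ⟨Y, hY, rfl⟩
  refine ⟨r ⟨Y, hY⟩, ⟨_, rfl⟩, ?_⟩
  ext Z
  exact (isometric_iff_of_card_eq_two hY).symm

theorem Isometric.refl (r : Pair X → C) (Y : Finset X) : Isometric r Y Y := by
  refine ⟨Equiv.refl _, ?_⟩
  funext U
  simp only [Function.comp_apply]
  congr 1
  apply Subtype.ext
  change U.1 = U.1.map _
  ext; simp

theorem Isometric.tri_eq [DecidableEq X] {x y z x' y' z' : X} (hxy : x ≠ y) (hxz : x ≠ z)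
    (hyz : y ≠ z) (h : Isometric r {x, y, z} {x', y', z'}) :
    tri (edgeColor r U₀ x y) (edgeColor r U₀ x z) (edgeColor r U₀ y z) =
      tri (edgeColor r U₀ x' y') (edgeColor r U₀ x' z') (edgeColor r U₀ y' z') := by
  obtain ⟨f, hf⟩ := h
  have key : ∀ u v : ({x, y, z} : Finset X), u ≠ v →
      edgeColor r U₀ u.1 v.1 = edgeColor r U₀ (f u).1 (f v).1 := by
    intro u v huv
    have h := congrFun hf ⟨{u, v}, Finset.card_pair huv⟩
    simp only [restrict, Function.comp_apply] at h
    have e1 := apply_eq_edgeColor (r := r) (U₀ := U₀)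
      (U := Pair.map (Function.Embedding.subtype (fun x_1 => x_1 ∈ ({x, y, z} : Finset X)))
        ⟨{u, v}, Finset.card_pair huv⟩) (x := u.1) (y := v.1)
      (fun h => huv (Subtype.ext h)) (by simp [Pair.map])
    have e2 := apply_eq_edgeColor (r := r) (U₀ := U₀)
      (U := Pair.map (Function.Embedding.subtype (fun x_1 => x_1 ∈ ({x', y', z'} : Finset X)))
        (Pair.map f.toEmbedding ⟨{u, v}, Finset.card_pair huv⟩)) (x := (f u).1) (y := (f v).1)
      (fun h => huv (f.injective (Subtype.ext h))) (by simp [Pair.map])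
    rw [← e1, ← e2, h]
  let u : ({x, y, z} : Finset X) := ⟨x, by simp⟩
  let v : ({x, y, z} : Finset X) := ⟨y, by simp⟩
  let w : ({x, y, z} : Finset X) := ⟨z, by simp⟩
  have huv : u ≠ v := fun h => hxy (congrArg Subtype.val h)
  have huw : u ≠ w := fun h => hxz (congrArg Subtype.val h)
  have hvw : v ≠ w := fun h => hyz (congrArg Subtype.val h)
  have k1 : edgeColor r U₀ x y = _ := key u v huv
  have k2 : edgeColor r U₀ x z = _ := key u w huw
  have k3 : edgeColor r U₀ y z = _ := key v w hvw
  have n1 : (f u).1 ≠ (f v).1 := fun h => huv (f.injective (Subtype.ext h))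
  have n2 : (f u).1 ≠ (f w).1 := fun h => huw (f.injective (Subtype.ext h))
  have n3 : (f v).1 ≠ (f w).1 := fun h => hvw (f.injective (Subtype.ext h))
  have hmem : ∀ p : ({x', y', z'} : Finset X), p.1 = x' ∨ p.1 = y' ∨ p.1 = z' := by
    intro p
    have := p.2
    rwa [Finset.mem_insert, Finset.mem_insert, Finset.mem_singleton] at this
  have m1 : (f u).1 = x' ∨ (f u).1 = y' ∨ (f u).1 = z' := hmem _
  have m2 : (f v).1 = x' ∨ (f v).1 = y' ∨ (f v).1 = z' := hmem _
  have m3 : (f w).1 = x' ∨ (f w).1 = y' ∨ (f w).1 = z' := hmem _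
  rw [k1, k2, k3]
  have c1 := edgeColor_comm (r := r) (U₀ := U₀) x' y'
  have c2 := edgeColor_comm (r := r) (U₀ := U₀) x' z'
  have c3 := edgeColor_comm (r := r) (U₀ := U₀) y' z'
  generalize (f u).1 = p at *
  generalize (f v).1 = q at *
  generalize (f w).1 = s at *
  rw [tri_eq_iff]
  rcases m1 with rfl | rfl | rfl <;> rcases m2 with rfl | rfl | rfl <;>
    rcases m3 with rfl | rfl | rfl <;> first
      | exact absurd rfl n1
      | exact absurd rfl n2
      | exact absurd rfl n3
      | simp [c1, c2, c3]

/-- Choose for each type the isometry class of a triangle realizing it; by `Isometric.tri_eq` this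
choice is injective. -/
theorem types_le_a_three [Finite X] :
    {t | IsType (edgeColor r U₀) t}.ncard ≤ a 3 r := by
  classical
  have hex : ∀ t, IsType (edgeColor r U₀) t → ∃ c : Set (Finset X), c ∈ isometryClasses r 3 ∧
      ∃ x y z, x ≠ y ∧ x ≠ z ∧ y ≠ z ∧ c = {Z | Isometric r {x, y, z} Z} ∧
        t = tri (edgeColor r U₀ x y) (edgeColor r U₀ x z) (edgeColor r U₀ y z) := by
    rintro t ⟨x, y, z, hxy, hxz, hyz, ht⟩
    exact ⟨_, ⟨{x, y, z}, Finset.card_eq_three.2 ⟨x, y, z, hxy, hxz, hyz, rfl⟩, rfl⟩,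
      x, y, z, hxy, hxz, hyz, rfl, ht⟩
  choose! c hc hc' using hex
  refine Set.ncard_le_ncard_of_injOn c (fun t ht => hc t ht) ?_ (Set.toFinite _)
  intro t ht s hs hts
  obtain ⟨x, y, z, hxy, hxz, hyz, h, h'⟩ := hc' t ht
  obtain ⟨x', y', z', -, -, -, g, g'⟩ := hc' s hs
  rw [h', g']
  apply Isometric.tri_eq hxy hxz hyz
  have : ({x', y', z'} : Finset X) ∈ {Z | Isometric r {x', y', z'} Z} := Isometric.refl r _
  rw [← g, ← hts, h] at this
  exact this

end

/-! ### Reading the three forms off the color function -/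

section
variable {X C : Type*} {r : Pair X → C} {U₀ : Pair X}

/-- The color classes of the colors outside `S`. -/
def classesOutside (r : Pair X → C) (S : Set C) : Set (Set (Pair X)) :=
  (fun p => r ⁻¹' {p}) '' (Set.range r \ S)

theorem sUnion_classesOutside (S : Set C) : ⋃₀ classesOutside r S = {U | r U ∉ S} := by
  ext U
  constructor
  · rintro ⟨_, ⟨p, hp, rfl⟩, hU⟩
    have : r U = p := hU
    rw [Set.mem_ofPred_eq, this]; exact hp.2
  · intro hU
    exact ⟨_, ⟨r U, ⟨⟨U, rfl⟩, hU⟩, rfl⟩, rfl⟩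

theorem isMatching_of_forall [DecidableEq X] {E : Set (Pair X)}
    (h : ∀ U ∈ E, ∀ V ∈ E, ∀ x y z : X, x ≠ y → x ≠ z → y ≠ z → U.1 = {x, y} → V.1 = {x, z} →
      False) : IsMatching E := by
  intro U hU V hV hUV
  rw [Finset.disjoint_left]
  intro x hxU hxV
  have key : ∀ (W : Pair X), x ∈ W.1 → ∃ y, x ≠ y ∧ W.1 = {x, y} := by
    intro W hx
    obtain ⟨a, b, hab, ha⟩ := Finset.card_eq_two.1 W.2
    rw [ha, Finset.mem_insert, Finset.mem_singleton] at hx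
    rcases hx with rfl | rfl
    · exact ⟨b, hab, ha⟩
    · exact ⟨a, hab.symm, by rw [ha]; ext; simp [or_comm]⟩
  obtain ⟨y, hxy, hy⟩ := key U hxU
  obtain ⟨z, hxz, hz⟩ := key V hxV
  refine h U hU V hV x y z hxy hxz ?_ hy hz
  rintro rfl
  exact hUV (Subtype.ext (hy.trans hz.symm))

theorem disjointMatchings_classesOutside [DecidableEq X] {S : Set C}
    (h : ∀ x y z : X, x ≠ y → x ≠ z → y ≠ z → edgeColor r U₀ x y ∈ S ∨ edgeColor r U₀ x z ∈ S) :
    DisjointMatchings (classesOutside r S) := by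
  have hU : IsMatching (⋃₀ classesOutside r S) := by
    rw [sUnion_classesOutside]
    apply isMatching_of_forall
    intro U hU V hV x y z hxy hxz hyz hUx hVx
    rw [Set.mem_ofPred_eq, apply_eq_edgeColor (r := r) (U₀ := U₀) hxy hUx] at hU
    rw [Set.mem_ofPred_eq, apply_eq_edgeColor (r := r) (U₀ := U₀) hxz hVx] at hV
    rcases h x y z hxy hxz hyz with h | h
    exacts [hU h, hV h]
  exact ⟨fun E hE V hV W hW => hU V ⟨E, hE, hV⟩ W ⟨E, hE, hW⟩, hU⟩

theorem mem_between_iff [DecidableEq X] {S T : Set X} {U : Pair X} {x y : X}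
    (hU : U.1 = {x, y}) : U ∈ between S T ↔ x ∈ S ∧ y ∈ T ∨ y ∈ S ∧ x ∈ T := by
  have hU' : (U.1 : Set X) = {x, y} := by rw [hU]; simp
  constructor
  · rintro ⟨s, hs, t, ht, h⟩
    rw [hU', Set.pair_eq_pair_iff] at h
    rcases h with ⟨rfl, rfl⟩ | ⟨rfl, rfl⟩
    · exact Or.inl ⟨hs, ht⟩
    · exact Or.inr ⟨hs, ht⟩
  · rintro (⟨hx, hy⟩ | ⟨hy, hx⟩)
    · exact ⟨x, hx, y, hy, hU'⟩
    · exact ⟨y, hy, x, hx, hU'.trans (Set.pair_comm x y)⟩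

theorem mem_clique_iff [DecidableEq X] {S : Set X} {U : Pair X} {x y : X} (hU : U.1 = {x, y}) :
    U ∈ clique S ↔ x ∈ S ∧ y ∈ S := by
  have hU' : (U.1 : Set X) = {x, y} := by rw [hU]; simp
  change (U.1 : Set X) ⊆ S ↔ _
  rw [hU', Set.insert_subset_iff, Set.singleton_subset_iff]

theorem matchingForm_of_forall [Fintype X] (hX : 3 ≤ Fintype.card X) {u : C}
    (h : ∀ x y z : X, x ≠ y → x ≠ z → y ≠ z →
      edgeColor r U₀ x y = u ∨ edgeColor r U₀ x z = u) : MatchingForm (colorClasses r) := by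
  classical
  obtain ⟨x, y, z, hxy, hxz, hyz⟩ := Fintype.two_lt_card_iff.1 hX
  -- The set of remaining edges is a color class only if `u` occurs.
  have hu : u ∈ Set.range r := by
    rw [← colorSet_edgeColor (U₀ := U₀)]
    rcases h x y z hxy hxz hyz with h | h
    exacts [⟨x, y, hxy, h⟩, ⟨x, z, hxz, h⟩]
  refine ⟨classesOutside r {u}, disjointMatchings_classesOutside h, ?_⟩
  have hc : (⋃₀ classesOutside r {u})ᶜ = r ⁻¹' {u} := by
    rw [sUnion_classesOutside]; ext U; simp
  rw [hc, classesOutside, ← Set.image_singleton (f := fun p => r ⁻¹' {p}), ← Set.image_union,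
    Set.sdiff_union_of_subset (Set.singleton_subset_iff.2 hu)]
  rfl

theorem twoCliqueForm_of_forall [Fintype X] (hX : 3 ≤ Fintype.card X) {α γ : C} {Y : Set X}
    (hY : Y.Nonempty) (hY' : Yᶜ.Nonempty) (hαγ : α ≠ γ)
    (h₁ : ∀ x ∈ Y, ∀ x' ∈ Y, x ≠ x' → edgeColor r U₀ x x' = γ)
    (h₂ : ∀ x ∉ Y, ∀ x' ∉ Y, x ≠ x' → edgeColor r U₀ x x' = γ)
    (h₃ : ∀ x ∉ Y, ∀ w ∈ Y, edgeColor r U₀ x w ≠ γ)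
    (h₄ : ∀ x ∉ Y, ∀ w ∈ Y, ∀ w' ∈ Y, w ≠ w' →
      edgeColor r U₀ x w = α ∨ edgeColor r U₀ x w' = α)
    (h₅ : ∀ w ∈ Y, ∀ x ∉ Y, ∀ x' ∉ Y, x ≠ x' →
      edgeColor r U₀ x w = α ∨ edgeColor r U₀ x' w = α) : TwoCliqueForm (colorClasses r) := by
  classical
  have hcomm := edgeColor_comm (r := r) (U₀ := U₀)
  obtain ⟨w, hw⟩ := hY
  obtain ⟨x, hx⟩ := hY'
  have hxw : x ≠ w := fun h => hx (h ▸ hw)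
  -- On whichever side a third point lies, it produces both an edge of color `α` and one of color
  -- `γ`.
  obtain ⟨v, hvx, hvw⟩ : ∃ v, v ≠ x ∧ v ≠ w := by
    have hc := Finset.card_le_two (a := x) (b := w)
    obtain ⟨v, hv⟩ : ({x, w} : Finset X)ᶜ.Nonempty := by
      rw [← Finset.card_pos, Finset.card_compl]; omega
    simp only [Finset.mem_compl, Finset.mem_insert, Finset.mem_singleton, not_or] at hv
    exact ⟨v, hv⟩
  have hα : α ∈ Set.range r := by
    rw [← colorSet_edgeColor (U₀ := U₀)]
    by_cases hv : v ∈ Y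
    · rcases h₄ x hx v hv w hw hvw with h | h
      exacts [⟨x, v, hvx.symm, h⟩, ⟨x, w, hxw, h⟩]
    · rcases h₅ w hw v hv x hx hvx with h | h
      exacts [⟨v, w, hvw, h⟩, ⟨x, w, hxw, h⟩]
  have hγ : γ ∈ Set.range r := by
    rw [← colorSet_edgeColor (U₀ := U₀)]
    by_cases hv : v ∈ Y
    exacts [⟨v, w, hvw, h₁ v hv w hw hvw⟩, ⟨v, x, hvx, h₂ v hv x hx hvx⟩]
  have hcl : clique Y ∪ clique Yᶜ = r ⁻¹' {γ} := by
    ext U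
    obtain ⟨x, y, hxy, hU, hc⟩ := exists_pair r U₀ U
    rw [Set.mem_union, mem_clique_iff hU, mem_clique_iff hU, Set.mem_preimage, hc,
      Set.mem_singleton_iff, Set.mem_compl_iff, Set.mem_compl_iff]
    constructor
    · rintro (⟨hx, hy⟩ | ⟨hx, hy⟩)
      exacts [h₁ x hx y hy hxy, h₂ x hx y hy hxy]
    · intro h
      by_cases hx : x ∈ Y
      · by_cases hy : y ∈ Y
        · exact Or.inl ⟨hx, hy⟩
        · exact absurd (by rw [hcomm, h]) (h₃ y hy x hx)
      · by_cases hy : y ∈ Y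
        · exact absurd h (h₃ x hx y hy)
        · exact Or.inr ⟨hx, hy⟩
  refine ⟨Y, Yᶜ, ⟨w, hw⟩, ⟨x, hx⟩, disjoint_compl_right, Set.union_compl_self Y,
    classesOutside r {α, γ}, disjointMatchings_classesOutside (U₀ := U₀) ?_, ?_, ?_⟩
  · intro x y z hxy hxz hyz
    simp only [Set.mem_insert_iff, Set.mem_singleton_iff]
    by_cases hx : x ∈ Y <;> by_cases hy : y ∈ Y
    · exact Or.inl (Or.inr (h₁ x hx y hy hxy))
    · by_cases hz : z ∈ Y
      · exact Or.inr (Or.inr (h₁ x hx z hz hxz))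
      · rw [hcomm x y, hcomm x z]
        exact (h₅ x hx y hy z hz hyz).imp Or.inl Or.inl
    · by_cases hz : z ∈ Y
      · exact (h₄ x hx y hy z hz hyz).imp Or.inl Or.inl
      · exact Or.inr (Or.inr (h₂ x hx z hz hxz))
    · exact Or.inl (Or.inr (h₂ x hx y hy hxy))
  · rintro _ ⟨p, hp, rfl⟩ U hU
    obtain ⟨x, y, hxy, hUx, hc⟩ := exists_pair r U₀ U
    have hne : U ∉ clique Y ∪ clique Yᶜ := by
      rw [hcl]
      intro h
      have h1 : r U = p := hU
      have h2 : r U = γ := h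
      exact hp.2 (Or.inr (h1.symm.trans h2))
    rw [Set.mem_union, mem_clique_iff hUx, mem_clique_iff hUx, Set.mem_compl_iff,
      Set.mem_compl_iff] at hne
    rw [mem_between_iff hUx, Set.mem_compl_iff, Set.mem_compl_iff]
    tauto
  · have hc : (clique Y ∪ clique Yᶜ ∪ ⋃₀ classesOutside r {α, γ})ᶜ = r ⁻¹' {α} := by
      rw [hcl, sUnion_classesOutside]
      ext U
      simp only [Set.mem_compl_iff, Set.mem_union, Set.mem_preimage, Set.mem_singleton_iff,
        Set.mem_ofPred_eq, Set.mem_insert_iff]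
      grind
    rw [hc, hcl, classesOutside, ← Set.image_singleton (f := fun p => r ⁻¹' {p}) (a := γ),
      ← Set.image_singleton (f := fun p => r ⁻¹' {p}) (a := α), ← Set.image_union,
      ← Set.image_union]
    change _ '' _ = _
    congr 1
    ext p
    simp only [Set.mem_union, Set.mem_singleton_iff, Set.mem_sdiff, Set.mem_insert_iff]
    grind

theorem singleEdgeForm_of_forall [Fintype X] (hX : 4 ≤ Fintype.card X) {α β γ : C} {y z : X}
    (hyz : y ≠ z)
    (h4 : ∀ p q s, ∃ x x', x ≠ x' ∧ edgeColor r U₀ x x' ≠ p ∧ edgeColor r U₀ x x' ≠ q ∧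
      edgeColor r U₀ x x' ≠ s)
    (h : ∀ x, x ≠ y → x ≠ z → edgeColor r U₀ y x = α ∧ edgeColor r U₀ z x = β ∧
      ∀ x', x' ≠ y → x' ≠ z → x ≠ x' → edgeColor r U₀ x x' = γ) :
    SingleEdgeForm (colorClasses r) ∧ (Set.range r).ncard ≤ 4 := by
  classical
  have hcomm := edgeColor_comm (r := r) (U₀ := U₀)
  set ε := edgeColor r U₀ y z with hε
  have hall : ∀ x x', x ≠ x' →
      (x = y ∧ x' = z ∨ x = z ∧ x' = y) ∧ edgeColor r U₀ x x' = ε ∨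
      (x = y ∧ x' ≠ y ∧ x' ≠ z ∨ x' = y ∧ x ≠ y ∧ x ≠ z) ∧ edgeColor r U₀ x x' = α ∨
      (x = z ∧ x' ≠ y ∧ x' ≠ z ∨ x' = z ∧ x ≠ y ∧ x ≠ z) ∧ edgeColor r U₀ x x' = β ∨
      (x ≠ y ∧ x ≠ z ∧ x' ≠ y ∧ x' ≠ z) ∧ edgeColor r U₀ x x' = γ := by
    intro x x' hxx'
    by_cases x₁ : x = y <;> by_cases x₂ : x = z <;> by_cases x₃ : x' = y <;>
      by_cases x₄ : x' = z <;> grind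
  have hcol : ∀ x x', x ≠ x' → edgeColor r U₀ x x' = ε ∨ edgeColor r U₀ x x' = α ∨
      edgeColor r U₀ x x' = β ∨ edgeColor r U₀ x x' = γ := by
    intro x x' hxx'
    have := hall x x' hxx'
    tauto
  -- At least four colors occur and these four are the only candidates, so any coincidence among
  -- them is excluded.
  have hthree : ∀ p q s, ¬ (∀ c, c = ε ∨ c = α ∨ c = β ∨ c = γ → c = p ∨ c = q ∨ c = s) := by
    intro p q s hh
    obtain ⟨x, x', hxx', n₁, n₂, n₃⟩ := h4 p q s
    rcases hh _ (hcol x x' hxx') with h | h | h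
    exacts [n₁ h, n₂ h, n₃ h]
  have d₁ : ε ≠ α := fun e => hthree α β γ (by grind)
  have d₂ : ε ≠ β := fun e => hthree α β γ (by grind)
  have d₃ : ε ≠ γ := fun e => hthree α β γ (by grind)
  have d₄ : α ≠ β := fun e => hthree ε β γ (by grind)
  have d₅ : α ≠ γ := fun e => hthree ε β γ (by grind)
  have d₆ : β ≠ γ := fun e => hthree ε α γ (by grind)
  obtain ⟨u, v, hu, hv, huv⟩ : ∃ u v, (u ≠ y ∧ u ≠ z) ∧ (v ≠ y ∧ v ≠ z) ∧ u ≠ v := by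
    have hc := Finset.card_le_two (a := y) (b := z)
    have : 1 < ({y, z} : Finset X)ᶜ.card := by rw [Finset.card_compl]; omega
    obtain ⟨u, hu, v, hv, huv⟩ := Finset.one_lt_card.1 this
    simp only [Finset.mem_compl, Finset.mem_insert, Finset.mem_singleton, not_or] at hu hv
    exact ⟨u, v, hu, hv, huv⟩
  have hrange : Set.range r = {ε, α, β, γ} := by
    rw [← colorSet_edgeColor (U₀ := U₀)]
    ext p
    simp only [Set.mem_insert_iff, Set.mem_singleton_iff]
    constructor
    · rintro ⟨x, x', hxx', rfl⟩
      exact hcol x x' hxx'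
    · rintro (rfl | rfl | rfl | rfl)
      · exact ⟨y, z, hyz, rfl⟩
      · exact ⟨y, u, hu.1.symm, (h u hu.1 hu.2).1⟩
      · exact ⟨z, u, hu.2.symm, (h u hu.1 hu.2).2.1⟩
      · exact ⟨u, v, huv, (h u hu.1 hu.2).2.2 v hv.1 hv.2 huv⟩
  have e₁ : between {y} {z} = r ⁻¹' {ε} := by
    ext U
    obtain ⟨x, x', hxx', hU, hc⟩ := exists_pair r U₀ U
    rw [mem_between_iff hU, Set.mem_preimage, hc]
    simp only [Set.mem_singleton_iff]
    have := hall x x' hxx'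
    clear h4 hall hcol hthree h
    grind
  have e₂ : between {y} {y, z}ᶜ = r ⁻¹' {α} := by
    ext U
    obtain ⟨x, x', hxx', hU, hc⟩ := exists_pair r U₀ U
    rw [mem_between_iff hU, Set.mem_preimage, hc]
    simp only [Set.mem_singleton_iff, Set.mem_compl_iff, Set.mem_insert_iff, not_or]
    have := hall x x' hxx'
    clear h4 hall hcol hthree h
    grind
  have e₃ : between {z} {y, z}ᶜ = r ⁻¹' {β} := by
    ext U
    obtain ⟨x, x', hxx', hU, hc⟩ := exists_pair r U₀ U
    rw [mem_between_iff hU, Set.mem_preimage, hc]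
    simp only [Set.mem_singleton_iff, Set.mem_compl_iff, Set.mem_insert_iff, not_or]
    have := hall x x' hxx'
    clear h4 hall hcol hthree h
    grind
  have e₄ : (r ⁻¹' {ε} ∪ r ⁻¹' {α} ∪ r ⁻¹' {β})ᶜ = r ⁻¹' {γ} := by
    ext U
    have hU : r U ∈ ({ε, α, β, γ} : Set C) := hrange ▸ ⟨U, rfl⟩
    simp only [Set.mem_insert_iff, Set.mem_singleton_iff] at hU
    simp only [Set.mem_compl_iff, Set.mem_union, Set.mem_preimage, Set.mem_singleton_iff]
    clear h4 hall hcol hthree h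
    grind
  constructor
  · refine ⟨y, z, hyz, ?_⟩
    rw [e₁, e₂, e₃, e₄, colorClasses, hrange]
    simp only [Set.image_insert_eq, Set.image_singleton]
  · rw [hrange]
    have h₁ := Set.ncard_insert_le ε ({α, β, γ} : Set C)
    have h₂ := Set.ncard_insert_le α ({β, γ} : Set C)
    have h₃ := Set.ncard_insert_le β ({γ} : Set C)
    rw [Set.ncard_singleton] at h₃
    omega

end
end ColoredSpace

theorem theorem1p2 {X C : Type*} [Finite X] (r : ColoredSpace.Pair X → C)
    (hX : 9 ≤ Nat.card X) (h4 : 4 ≤ ColoredSpace.a 2 r)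
    (h23 : ColoredSpace.a 2 r = ColoredSpace.a 3 r) :
    ColoredSpace.MatchingForm (ColoredSpace.colorClasses r) ∨
      ColoredSpace.TwoCliqueForm (ColoredSpace.colorClasses r) ∨
      (ColoredSpace.SingleEdgeForm (ColoredSpace.colorClasses r) ∧
        ColoredSpace.a 2 r = 4 ∧ ColoredSpace.a 3 r = 4) := by
  classical
  have := Fintype.ofFinite X
  rw [Nat.card_eq_fintype_card] at hX
  obtain ⟨x₀, y₀, hxy₀⟩ := Fintype.one_lt_card_iff.1 (by omega : 1 < Fintype.card X)
  let U₀ : ColoredSpace.Pair X := ⟨{x₀, y₀}, Finset.card_pair hxy₀⟩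
  have h2 := ColoredSpace.a_two_le r
  have h3 := ColoredSpace.types_le_a_three (r := r) (U₀ := U₀)
  obtain ⟨D⟩ := ColoredSpace.nonempty_dualWeights (col := ColoredSpace.edgeColor r U₀) (by omega)
    ColoredSpace.edgeColor_comm (by rw [ColoredSpace.colorSet_edgeColor]; omega)
  have hcol : ∀ p q s, ∃ x x', x ≠ x' ∧ ColoredSpace.edgeColor r U₀ x x' ≠ p ∧
      ColoredSpace.edgeColor r U₀ x x' ≠ q ∧ ColoredSpace.edgeColor r U₀ x x' ≠ s := by
    intro p q s
    by_contra! hcon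
    have hsub : Set.range r ⊆ {p, q, s} := by
      rw [← ColoredSpace.colorSet_edgeColor (U₀ := U₀)]
      rintro _ ⟨x, x', hxx', rfl⟩
      simp only [Set.mem_insert_iff, Set.mem_singleton_iff]
      have := hcon x x' hxx'
      tauto
    have h₀ := Set.ncard_le_ncard hsub (Set.toFinite _)
    have h₁ := Set.ncard_insert_le p ({q, s} : Set C)
    have h₂ := Set.ncard_insert_le q ({s} : Set C)
    rw [Set.ncard_singleton] at h₂
    omega
  rcases D.trichotomy hX hcol with ⟨u, h⟩ | ⟨α, γ, Y, hY, hY', hαγ, g₁, g₂, g₃, g₄, g₅⟩ |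
    ⟨α, β, γ, y, z, hyz, h⟩
  · exact Or.inl (ColoredSpace.matchingForm_of_forall (by omega) h)
  · exact Or.inr (Or.inl (ColoredSpace.twoCliqueForm_of_forall (by omega) hY hY' hαγ g₁ g₂ g₃ g₄ g₅))
  · obtain ⟨h, hr⟩ := ColoredSpace.singleEdgeForm_of_forall (by omega) hyz hcol h
    -- The bounds `4 ≤ a 2 r ≤ (Set.range r).ncard ≤ 4` give equality.
    exact Or.inr (Or.inr ⟨h, by omega, by omega⟩)
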